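/- Let $\gamma$ be Euler's constant and $\psi=\Gamma'/\Gamma$ the digamma function. For $\alpha>0$ and $s>0$ put $$g_\infty(\alpha;s)=\frac1{2\pi}\lim_{T\to\infty}\int_{-T}^{T} e^{-ist}\exp\left(-\frac{\gamma}{\alpha}-\frac1\alpha\,\psi(1-it\alpha)\right)dt,$$ and for $\sigma\ge 0$ put $$G_\infty(\alpha;\sigma)=\int_0^\sigma g_\infty(\alpha;s)\,ds .$$ For every $\alpha>0$ the limit defining $g_\infty(\alpha;s)$ exists and is real for every $s>0$, and $g_\infty(\alpha;\cdot)$ is integrable on $(0,\sigma)$ for every $\sigma\ge0$. There are functions $f_k:[0,\infty)\to\mathbb R$, $k\ge 1$, not depending on $\alpha$, such that for all $\alpha>0$ and $\sigma\ge 0$, with $y=\sigma/\alpha$, the series $\sum_{k\ge1} f_k(y)\alpha^{-k}$ converges and $$G_\infty(\alpha;\sigma)=\left(1-e^{-y}\right)^{1/\alpha}\left(1+\sum_{k=1}^{\infty}\frac{f_k(y)}{\alpha^k}\right).$$ Here $f_1=0$ on $[0,\infty)$, so that the sum starts at $k=2$, and $$f_2(y)=\frac y2\ln\left(1-e^{-y}\right)-\frac12\sum_{l=1}^\infty\frac{e^{-ly}}{l^2}\qquad(y\ge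 0),$$ where the first term is read as $0$ at $y=0$. The function $f_2$ is monotonically increasing on $[0,\infty)$, with $f_2(0)=\lim_{y\to0^+}f_2(y)=-\frac{\pi^2}{12}$ and $\lim_{y\to\infty}f_2(y)=0$. -/

import Mathlib

open Filter Topology MeasureTheory

noncomputable section

/-- The limiting characteristic function
`t ↦ exp (-γ/α - ψ(1 - i t α)/α)`, where `ψ` is the digamma function. -/
def charInf (α t : ℝ) : ℂ :=
  Complex.exp (-(Real.eulerMascheroniConstant : ℂ) / (α : ℂ)
    - (1 / (α : ℂ)) * Complex.digamma (1 - Complex.I * (t : ℂ) * (α : ℂ)))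

/-- The truncated inverse Fourier integral
`(1 / 2π) ∫_{-T}^{T} e^{-i s t} charInf α t dt`. -/
def gInfTrunc (α s T : ℝ) : ℂ :=
  (1 / (2 * (Real.pi : ℂ))) *
    ∫ t in (-T)..T, Complex.exp (-(Complex.I * (s : ℂ) * (t : ℂ))) * charInf α t

/-- The density `g_∞(α; s) = (1 / 2π) ∫_{-∞}^{∞} e^{-i s t} charInf α t dt`. Since
`|charInf α t|` decays only like `|t| ^ (-1/α)`, the integral over `ℝ` is the limit of its
symmetric truncations. -/
def gInf (α s : ℝ) : ℝ :=
  (limUnder atTop (fun T : ℝ => gInfTrunc α s T)).re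

/-- The cumulative distribution function `G_∞(α; σ) = ∫_0^σ g_∞(α; s) ds`. -/
def GInf (α σ : ℝ) : ℝ :=
  ∫ s in (0 : ℝ)..σ, gInf α s

/-- `f₂(y) = (y/2) ln (1 - e^{-y}) - (1/2) ∑_{l ≥ 1} e^{-l y} / l²`; at `y = 0` the first term
has the value `0`, which is also its limit. -/
def fTwo (y : ℝ) : ℝ :=
  y / 2 * Real.log (1 - Real.exp (-y))
    - 1 / 2 * ∑' l : ℕ, Real.exp (-(((l : ℝ) + 1) * y)) / ((l : ℝ) + 1) ^ 2

end

/-! Put `a = 1/α`, `y = s/α` and `H = harm`. With `z = -iαt` the integrand of `g_∞` becomes `e^{zy}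
e^{-aH(z)}`, so the density is an inverse Laplace transform along the imaginary axis. The integrand
is symmetric under conjugation, so half of the line suffices and only an imaginary part matters. The
half line is bent to a half Hankel contour (up by `i`, then left to `-∞ + i`), on which `e^{zy}`
decays exponentially. This rests on `H(z) = log(1 + z) + O(1)` away from the poles
(`norm_harm_sub_log_le`): `e^{-aH}` decays in the upper half plane, which allows the bending
(`tendsto_vertical_hankel`), and every `e^{b|H|}` grows at most polynomially on the contour.

Dividing by `z` integrates in `y`, so `G_∞` is `1/π` times the imaginary part of the contour
integral of `e^{zy} e^{-aH(z)}/z`; moving the start of the contour to `1/y` shows that it vanishes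
as `y → 0` (`tendsto_hankelCdf_zero`). Multiplying by `e^{-aL}`, `L = log(1 - e^{-y})`, and
expanding the exponential in powers of `a` under the integral gives a convergent series
(`hasSum_expansionCoeff`), whose coefficients are combinations of `I_k(y) = Im ∫ e^{zy} H^k/z`.

These are found for `k ≤ 2` from `E_k = I_k' = Im ∫ e^{zy} H^k`. Translating the contour by `1` and
using `H(z - 1) = H(z) - 1/z` expresses `(e^y - 1) E_k` by integrals with lower powers of `H`
(`exp_mul_hankel_harm_pow`). For `k ≥ 1` the constant of integration is fixed by `I_k → 0` at
infinity, because `H(0) = 0` cancels the pole at `0` (`tendsto_hankel_harm_pow_div`). The result is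
`I_0 = π`, `I_1 = -πL`, `I_2 = π(L² + 2 f₂)`. Hence the first-order coefficient cancels and the
second is `f₂`. -/

/-! ### The function `H`: conjugation symmetry and recurrence. -/

/-- The harmonic number function `H(z) = ψ(1 + z) + γ`. -/
noncomputable def harm (z : ℂ) : ℂ :=
  Complex.digamma (1 + z) + (Real.eulerMascheroniConstant : ℂ)

theorem charInf_eq_exp_harm (α t : ℝ) :
    charInf α t = Complex.exp (-((1 / α : ℝ) : ℂ) * harm (-(Complex.I * ((t * α : ℝ) : ℂ)))) := by
  unfold charInf harm
  congr 1
  push_cast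
  rw [show (1 : ℂ) + -(Complex.I * (t * α)) = 1 - Complex.I * t * α by ring]
  ring

theorem slitPlane_ne_neg_nat {z : ℂ} (hz : z ∈ Complex.slitPlane) (m : ℕ) : z ≠ -(m : ℂ) := by
  rintro rfl
  rcases Complex.mem_slitPlane_iff.1 hz with h | h
  · have : (0 : ℝ) ≤ m := m.cast_nonneg
    simp at h
    linarith
  · simp at h

theorem differentiableAt_digamma {z : ℂ} (hz : z ∈ Complex.slitPlane) :
    DifferentiableAt ℂ Complex.digamma z := by
  have hd : DifferentiableOn ℂ Complex.Gamma Complex.slitPlane := fun w hw =>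
    (Complex.differentiableAt_Gamma w (slitPlane_ne_neg_nat hw)).differentiableWithinAt
  have h1 : DifferentiableAt ℂ (deriv Complex.Gamma) z :=
    (hd.deriv Complex.isOpen_slitPlane).differentiableAt (Complex.isOpen_slitPlane.mem_nhds hz)
  have h2 := Complex.differentiableAt_Gamma z (slitPlane_ne_neg_nat hz)
  exact h1.div h2 (Complex.Gamma_ne_zero (slitPlane_ne_neg_nat hz))

theorem differentiableAt_harm {z : ℂ} (hz : 1 + z ∈ Complex.slitPlane) :
    DifferentiableAt ℂ harm z := by
  unfold harm
  exact ((differentiableAt_digamma hz).comp z (by fun_prop)).add_const _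

theorem digamma_conj (z : ℂ) :
    Complex.digamma ((starRingEnd ℂ) z) = (starRingEnd ℂ) (Complex.digamma z) := by
  have h : deriv Complex.Gamma ((starRingEnd ℂ) z) = (starRingEnd ℂ) (deriv Complex.Gamma z) := by
    have h := congrFun (deriv_conj_conj (f := Complex.Gamma)) ((starRingEnd ℂ) z)
    have e : (starRingEnd ℂ) ∘ Complex.Gamma ∘ (starRingEnd ℂ) = Complex.Gamma := by
      ext w
      simp [Complex.Gamma_conj]
    rw [e] at h
    simpa using h
  rw [Complex.digamma_def, logDeriv_apply, logDeriv_apply, h, Complex.Gamma_conj, map_div₀]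

theorem harm_conj (z : ℂ) : harm ((starRingEnd ℂ) z) = (starRingEnd ℂ) (harm z) := by
  unfold harm
  rw [map_add, ← digamma_conj, map_add, map_one, Complex.conj_ofReal]

theorem harm_ofReal_im (x : ℝ) : (harm (x : ℂ)).im = 0 := by
  rw [← Complex.conj_eq_iff_im, ← harm_conj, Complex.conj_ofReal]

theorem harm_zero : harm 0 = 0 := by
  simp [harm, Complex.digamma_one]

theorem harm_add_one {z : ℂ} (hz : 1 + z ∈ Complex.slitPlane) :
    harm (z + 1) = harm z + (1 + z)⁻¹ := by
  unfold harm
  rw [show (1 : ℂ) + (z + 1) = (1 + z) + 1 by ring,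
    Complex.digamma_apply_add_one _ (slitPlane_ne_neg_nat hz)]
  ring

theorem one_add_mem_slitPlane_of_shift {z : ℂ} (hz : 1 + z ∈ Complex.slitPlane) :
    1 + (z + 1) ∈ Complex.slitPlane := by
  rw [Complex.mem_slitPlane_iff] at hz ⊢
  simp at hz ⊢
  rcases hz with h | h
  · left; linarith
  · right; exact h

/-! ### The Mittag-Leffler expansion of `H`. -/

theorem digamma_ofReal {x : ℝ} (hx : 0 < x) :
    Complex.digamma (x : ℂ) = ((deriv (Real.log ∘ Real.Gamma) x : ℝ) : ℂ) := by
  have hne : ∀ m : ℕ, x ≠ -m := fun m h => by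
    have : (0 : ℝ) ≤ m := m.cast_nonneg
    linarith
  have h1 : HasDerivAt (fun y : ℝ => ((Real.Gamma y : ℝ) : ℂ)) ((deriv Real.Gamma x : ℝ) : ℂ) x :=
    (Real.differentiableAt_Gamma hne).hasDerivAt.ofReal_comp
  have h2 : HasDerivAt (fun y : ℝ => Complex.Gamma (y : ℂ)) (deriv Complex.Gamma x) x :=
    (Complex.differentiableAt_Gamma x (slitPlane_ne_neg_nat
      (Complex.ofReal_mem_slitPlane.2 hx))).hasDerivAt.comp_ofReal
  have h3 : deriv Complex.Gamma x = ((deriv Real.Gamma x : ℝ) : ℂ) := by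
    refine h2.unique ?_
    simpa only [Complex.Gamma_ofReal] using h1
  rw [Real.deriv_log_comp_eq_logDeriv (Real.differentiableAt_Gamma hne) (Real.Gamma_pos_of_pos hx).ne',
    Complex.digamma_def, logDeriv_apply, logDeriv_apply, h3, Complex.Gamma_ofReal,
    Complex.ofReal_div]

/-- Log-convexity of `Γ`, in the spirit of Bohr–Mollerup. It lets values of `H` at real points be
compared with its values at integers, which are harmonic numbers. -/
theorem monotoneOn_re_harm : MonotoneOn (fun x : ℝ => (harm x).re) (Set.Ici 0) := by
  have hm : MonotoneOn (deriv (Real.log ∘ Real.Gamma)) (Set.Ioi 0) := by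
    refine Real.convexOn_log_Gamma.monotoneOn_deriv fun x hx => ?_
    have hne : ∀ m : ℕ, x ≠ -m := fun m h => by
      have : (0 : ℝ) ≤ m := m.cast_nonneg
      have hx' : 0 < x := hx
      linarith
    exact (Real.differentiableAt_log (Real.Gamma_pos_of_pos hx).ne').comp x
      (Real.differentiableAt_Gamma hne)
  intro x hx y hy hxy
  have hx' : (0 : ℝ) ≤ x := hx
  have hy' : (0 : ℝ) ≤ y := hy
  have e : ∀ t : ℝ, 0 ≤ t → (harm t).re
      = deriv (Real.log ∘ Real.Gamma) (1 + t) + Real.eulerMascheroniConstant := by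
    intro t ht
    unfold harm
    rw [show (1 : ℂ) + t = ((1 + t : ℝ) : ℂ) by push_cast; ring, digamma_ofReal (by linarith)]
    simp only [Complex.add_re, Complex.ofReal_re]
  simp only [e x hx', e y hy']
  have := hm (show 1 + x ∈ Set.Ioi (0 : ℝ) by simp; linarith)
    (show 1 + y ∈ Set.Ioi (0 : ℝ) by simp; linarith) (by linarith)
  linarith

/-- The partial sums of the Mittag-Leffler expansion of `harm`. -/
noncomputable def harmSum (n : ℕ) (z : ℂ) : ℂ :=
  ∑ k ∈ Finset.range n, (1 / ((k : ℂ) + 1) - 1 / ((k : ℂ) + 1 + z))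

/-- The recurrence iterated `n` times. The bracket is the remainder `H(z + n) - H(n)`, which has to
tend to `0`. -/
theorem harm_eq_harmSum_add {z : ℂ} (hz : 1 + z ∈ Complex.slitPlane) (n : ℕ) :
    harm z = harmSum n z + (harm (z + n) - ∑ k ∈ Finset.range n, 1 / ((k : ℂ) + 1)) := by
  have hmem : ∀ n : ℕ, 1 + (z + n) ∈ Complex.slitPlane := by
    intro n
    induction n with
    | zero => simpa using hz
    | succ n ih =>
      have := one_add_mem_slitPlane_of_shift ih
      push_cast
      rwa [← add_assoc z]
  induction n with
  | zero => simp [harmSum]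
  | succ n ih =>
    have h := harm_add_one (hmem n)
    rw [harmSum, Finset.sum_range_succ, ← harmSum, Finset.sum_range_succ]
    push_cast
    rw [← add_assoc z, h, ih]
    rw [show (n : ℂ) + 1 + z = 1 + (z + n) by ring, one_div (1 + (z + (n : ℂ)))]
    ring

theorem harm_natCast (n : ℕ) : harm (n : ℂ) = ∑ k ∈ Finset.range n, 1 / ((k : ℂ) + 1) := by
  have h := harm_eq_harmSum_add (z := 0) (by simp) n
  rw [harm_zero, zero_add] at h
  have h0 : harmSum n 0 = 0 := by simp [harmSum]
  rw [h0, zero_add] at h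
  exact (sub_eq_zero.1 h.symm)

theorem tendsto_harmSum_ofReal {x : ℝ} (hx : 0 ≤ x) :
    Tendsto (fun n : ℕ => harmSum n (x : ℂ)) atTop (𝓝 (harm x)) := by
  obtain ⟨m, hm⟩ := exists_nat_ge x
  have hmem : 1 + (x : ℂ) ∈ Complex.slitPlane := by
    rw [show (1 : ℂ) + x = ((1 + x : ℝ) : ℂ) by push_cast; ring, Complex.ofReal_mem_slitPlane]
    linarith
  have key : ∀ n : ℕ, harm x - harmSum n x = (((harm ((x + n : ℝ) : ℂ)).re
      - (harm ((n : ℝ) : ℂ)).re : ℝ) : ℂ) := by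
    intro n
    have h := harm_eq_harmSum_add hmem n
    rw [← harm_natCast] at h
    have e1 : ∀ t : ℝ, (((harm (t : ℂ)).re : ℝ) : ℂ) = harm t := fun t =>
      Complex.ext (by simp) (by simp [harm_ofReal_im])
    rw [Complex.ofReal_sub, e1, e1]
    push_cast
    rw [h]; ring
  -- By monotonicity the remainder is at most `H(m + n) - H(n)`, a sum of `m` terms, each at most
  -- `1/(n + 1)`.
  have hb : ∀ n : ℕ, ‖harm x - harmSum n x‖ ≤ m / ((n : ℝ) + 1) := by
    intro n
    rw [key, Complex.norm_real, Real.norm_eq_abs, abs_of_nonneg]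
    · have h1 : (harm ((x + n : ℝ) : ℂ)).re ≤ (harm ((m + n : ℝ) : ℂ)).re :=
        monotoneOn_re_harm (show (0 : ℝ) ≤ x + n by positivity)
          (show (0 : ℝ) ≤ m + n by positivity) (by linarith)
      have h2 : (harm ((m + n : ℝ) : ℂ)).re - (harm ((n : ℝ) : ℂ)).re ≤ m / ((n : ℝ) + 1) := by
        have e : harm ((m + n : ℝ) : ℂ) - harm ((n : ℝ) : ℂ)
            = ((∑ k ∈ Finset.range m, 1 / ((n : ℝ) + k + 1) : ℝ) : ℂ) := by
          rw [show (((m + n : ℝ) : ℝ) : ℂ) = ((n + m : ℕ) : ℂ) by push_cast; ring,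
            show (((n : ℝ) : ℝ) : ℂ) = ((n : ℕ) : ℂ) by push_cast; ring, harm_natCast, harm_natCast,
            Finset.sum_range_add]
          push_cast
          ring
        have e' := congrArg Complex.re e
        rw [Complex.sub_re, Complex.ofReal_re] at e'
        rw [e']
        calc _ ≤ ∑ k ∈ Finset.range m, 1 / ((n : ℝ) + 1) := by
              refine Finset.sum_le_sum fun k _ => one_div_le_one_div_of_le (by positivity) ?_
              have : (0 : ℝ) ≤ k := k.cast_nonneg
              linarith
          _ = m / ((n : ℝ) + 1) := by simp [div_eq_mul_inv]
      linarith
    · have h1 : (harm ((n : ℝ) : ℂ)).re ≤ (harm ((x + n : ℝ) : ℂ)).re :=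
        monotoneOn_re_harm (show (0 : ℝ) ≤ n by positivity)
          (show (0 : ℝ) ≤ x + n by positivity) (by linarith)
      linarith
  have h0 : Tendsto (fun n : ℕ => (m : ℝ) / ((n : ℝ) + 1)) atTop (𝓝 0) :=
    tendsto_const_nhds.div_atTop (tendsto_atTop_add_const_right _ _ tendsto_natCast_atTop_atTop)
  rw [tendsto_iff_norm_sub_tendsto_zero]
  refine squeeze_zero (fun _ => norm_nonneg _) (fun n => ?_) h0
  rw [norm_sub_rev]
  exact hb n

theorem norm_natCast_add_ge {z : ℂ} (hz : 0 < z.re) (k : ℕ) : (k : ℝ) + 1 ≤ ‖(k : ℂ) + 1 + z‖ := by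
  refine le_trans ?_ (Complex.re_le_norm _)
  simp
  exact hz.le

theorem norm_harm_term_le {z : ℂ} (hz : 0 < z.re) (k : ℕ) :
    ‖1 / ((k : ℂ) + 1) - 1 / ((k : ℂ) + 1 + z)‖ ≤ ‖z‖ * (1 / ((k : ℝ) + 1) ^ 2) := by
  have h1 := norm_natCast_add_ge hz k
  have hk : (0 : ℝ) < (k : ℝ) + 1 := by positivity
  have hne : (k : ℂ) + 1 + z ≠ 0 := norm_pos_iff.1 (hk.trans_le h1)
  have hne' : (k : ℂ) + 1 ≠ 0 := Nat.cast_add_one_ne_zero k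
  have e : 1 / ((k : ℂ) + 1) - 1 / ((k : ℂ) + 1 + z) = z / (((k : ℂ) + 1) * ((k : ℂ) + 1 + z)) := by
    field_simp
    ring
  have hn : ‖(k : ℂ) + 1‖ = (k : ℝ) + 1 := by
    rw [show (k : ℂ) + 1 = ((k + 1 : ℕ) : ℂ) by push_cast; rfl, Complex.norm_natCast]
    push_cast; rfl
  rw [e, norm_div, norm_mul, hn, mul_one_div]
  gcongr
  rw [sq]
  gcongr

theorem summable_one_div_succ_sq : Summable fun k : ℕ => 1 / ((k : ℝ) + 1) ^ 2 := by
  have := (summable_nat_add_iff 1).2 (Real.summable_one_div_nat_pow.2 (one_lt_two))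
  simpa using this

/-- Identity theorem: `H` and the sum of the series are holomorphic on a convex set and agree at the
real points near `1`. -/
theorem tendsto_harmSum_of_re_pos {z : ℂ} (hz : 0 < z.re) :
    Tendsto (fun n : ℕ => harmSum n z) atTop (𝓝 (harm z)) := by
  -- Large enough for the half disc to contain both `z` and `1`; boundedness makes the series
  -- converge uniformly there.
  set R : ℝ := ‖z‖ + 2 with hR
  set U : Set ℂ := {w | 0 < w.re} ∩ Metric.ball 0 R with hU
  have hUo : IsOpen U := (isOpen_lt continuous_const Complex.continuous_re).inter Metric.isOpen_ball
  have hconv : Convex ℝ U := (convex_halfSpace_re_gt 0).inter (convex_ball _ _)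
  have hsum : Summable fun k : ℕ => R * (1 / ((k : ℝ) + 1) ^ 2) := summable_one_div_succ_sq.mul_left _
  have hne : ∀ (k : ℕ), ∀ w ∈ U, (k : ℂ) + 1 + w ≠ 0 := fun k w hw =>
    norm_pos_iff.1 ((by positivity : (0 : ℝ) < (k : ℝ) + 1).trans_le (norm_natCast_add_ge hw.1 k))
  have hle : ∀ (k : ℕ), ∀ w ∈ U, ‖1 / ((k : ℂ) + 1) - 1 / ((k : ℂ) + 1 + w)‖
      ≤ R * (1 / ((k : ℝ) + 1) ^ 2) := by
    intro k w hw
    refine (norm_harm_term_le hw.1 k).trans ?_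
    have : ‖w‖ < R := by simpa using hw.2
    gcongr
  have hd : DifferentiableOn ℂ (fun w => ∑' k : ℕ, (1 / ((k : ℂ) + 1) - 1 / ((k : ℂ) + 1 + w))) U := by
    refine Complex.differentiableOn_tsum_of_summable_norm hsum (fun k w hw => ?_) hUo hle
    have := hne k w hw
    refine DifferentiableAt.differentiableWithinAt ?_
    fun_prop (disch := assumption)
  have hlim : ∀ w ∈ U, Tendsto (fun n : ℕ => harmSum n w) atTop
      (𝓝 (∑' k : ℕ, (1 / ((k : ℂ) + 1) - 1 / ((k : ℂ) + 1 + w)))) := fun w hw =>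
    (Summable.of_norm_bounded hsum (fun k => hle k w hw)).hasSum.tendsto_sum_nat
  have hdh : DifferentiableOn ℂ harm U := fun w hw =>
    (differentiableAt_harm (Complex.mem_slitPlane_iff.2 (Or.inl (by
      have : 0 < w.re := hw.1
      simp; linarith)))).differentiableWithinAt
  have h1 : (1 : ℂ) ∈ U := ⟨by simp, by simp [hR]; linarith [norm_nonneg z]⟩
  have hzU : z ∈ U := ⟨hz, by simp [hR]⟩
  have hfreq : ∃ᶠ w in 𝓝[≠] (1 : ℂ), harm w
      = ∑' k : ℕ, (1 / ((k : ℂ) + 1) - 1 / ((k : ℂ) + 1 + w)) := by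
    have ht : Tendsto (fun x : ℝ => (x : ℂ)) (𝓝[≠] (1 : ℝ)) (𝓝[≠] (1 : ℂ)) := by
      refine tendsto_nhdsWithin_of_tendsto_nhds_of_eventually_within _ ?_ ?_
      · have := (Complex.continuous_ofReal.tendsto (1 : ℝ))
        rw [Complex.ofReal_one] at this
        exact this.mono_left nhdsWithin_le_nhds
      · filter_upwards [self_mem_nhdsWithin] with x hx
        intro h
        exact hx (Complex.ofReal_injective (by simpa using h))
    refine ht.frequently (Eventually.frequently ?_)
    have hev : ∀ᶠ x : ℝ in 𝓝[≠] (1 : ℝ), (x : ℂ) ∈ U :=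
      (ht.mono_right nhdsWithin_le_nhds) (hUo.mem_nhds h1)
    filter_upwards [hev] with x hx
    have hx0 : 0 < x := by simpa using hx.1
    exact tendsto_nhds_unique (tendsto_harmSum_ofReal hx0.le) (hlim x hx)
  have heq := (hdh.analyticOnNhd hUo).eqOn_of_preconnected_of_frequently_eq (hd.analyticOnNhd hUo)
    hconv.isPreconnected h1 hfreq
  rw [heq hzU]
  exact hlim z hzU

/-- Induction on the number of unit steps to the right that bring `z` into the half plane `Re z >
0`; the recurrence and a reindexing of the sum carry the limit back. -/
theorem tendsto_harmSum {z : ℂ} (hz : 1 + z ∈ Complex.slitPlane) :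
    Tendsto (fun n : ℕ => harmSum n z) atTop (𝓝 (harm z)) := by
  obtain ⟨m, hm⟩ := exists_nat_gt (-z.re)
  induction m generalizing z with
  | zero => exact tendsto_harmSum_of_re_pos (by simpa using hm)
  | succ m ih =>
    have h := ih (z := z + 1) (one_add_mem_slitPlane_of_shift hz) (by
      push_cast at hm; simp; linarith)
    rw [harm_add_one hz] at h
    rw [← tendsto_add_atTop_iff_nat 1]
    have h0 : Tendsto (fun n : ℕ => 1 / ((n : ℂ) + 1)) atTop (𝓝 0) :=
      tendsto_one_div_add_atTop_nhds_zero_nat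
    have h2 := (h.add h0).sub_const ((1 + z)⁻¹)
    simp only [add_zero, add_sub_cancel_right] at h2
    refine h2.congr fun n => ?_
    simp only [harmSum, Finset.sum_sub_distrib]
    rw [Finset.sum_range_succ (fun k : ℕ => 1 / ((k : ℂ) + 1)),
      Finset.sum_range_succ' (fun k : ℕ => 1 / ((k : ℂ) + 1 + z))]
    have : ∀ k : ℕ, 1 / ((k : ℂ) + 1 + (z + 1)) = 1 / (((k + 1 : ℕ) : ℂ) + 1 + z) := by
      intro k; push_cast; congr 1; ring
    simp only [this]
    push_cast
    rw [show (0 : ℂ) + 1 + z = 1 + z by ring, one_div (1 + z)]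
    ring

/-! ### Logarithmic growth of `H`. -/

/-- The part of the plane, away from the poles of `harm`, in which `harm z = log (1 + z) + O(1)`. -/
def logRegion : Set ℂ := {z | -(1 / 2) ≤ z.re ∨ 1 ≤ z.im}

theorem one_add_mem_slitPlane_of_mem {z : ℂ} (hz : z ∈ logRegion) : 1 + z ∈ Complex.slitPlane := by
  rw [Complex.mem_slitPlane_iff]
  rcases hz with h | h
  · left; simp; linarith
  · right; simp; linarith

theorem add_mem_slitPlane_of_mem {z : ℂ} (hz : z ∈ logRegion) {u : ℝ} (hu : 1 ≤ u) :
    (u : ℂ) + z ∈ Complex.slitPlane := by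
  rw [Complex.mem_slitPlane_iff]
  rcases hz with h | h
  · left; simp; linarith
  · right; simp; linarith

/-- In the first case `u + Re z ≥ 1/2`, so `1 ≤ 4 (u + Re z)²`, whence the factor `5`; in the second
`1 ≤ (Im z)²`. -/
theorem sq_add_one_le_normSq {z : ℂ} (hz : z ∈ logRegion) {u : ℝ} (hu : 1 ≤ u) :
    (u + z.re) ^ 2 + 1 ≤ 5 * ‖(u : ℂ) + z‖ ^ 2 := by
  rw [← Complex.normSq_eq_norm_sq, Complex.normSq_apply]
  simp only [Complex.add_re, Complex.ofReal_re, Complex.add_im, Complex.ofReal_im, zero_add]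
  rcases hz with h | h
  · nlinarith [sq_nonneg z.im]
  · nlinarith [sq_nonneg (u + z.re)]

theorem norm_inv_sub_inv_le {z : ℂ} (hz : z ∈ logRegion) {v u : ℝ} (hv : 1 ≤ v) (hvu : v ≤ u)
    (huv : u ≤ v + 1) :
    ‖1 / ((v : ℂ) + z) - 1 / ((u : ℂ) + z)‖ ≤ 9 * (1 / (1 + (u + z.re) ^ 2)) := by
  have h1 := sq_add_one_le_normSq hz hv
  have h2 := sq_add_one_le_normSq hz (hv.trans hvu)
  have n1 := Complex.slitPlane_ne_zero (add_mem_slitPlane_of_mem hz hv)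
  have n2 := Complex.slitPlane_ne_zero (add_mem_slitPlane_of_mem hz (hv.trans hvu))
  have e : 1 / ((v : ℂ) + z) - 1 / ((u : ℂ) + z)
      = ((u - v : ℝ) : ℂ) / (((v : ℂ) + z) * ((u : ℂ) + z)) := by
    field_simp
    push_cast
    ring
  rw [e, norm_div, norm_mul, Complex.norm_real, Real.norm_eq_abs, abs_of_nonneg (by linarith),
    mul_one_div, div_le_div_iff₀ (mul_pos (norm_pos_iff.2 n1) (norm_pos_iff.2 n2)) (by positivity)]
  set p := ‖(v : ℂ) + z‖ with hp
  set q := ‖(u : ℂ) + z‖ with hq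
  set w := u + z.re with hw
  have hp0 : 0 ≤ p := norm_nonneg _
  have hq0 : 0 ≤ q := norm_nonneg _
  -- Replacing `v` by `u` moves the real part by at most `1`, which costs a factor `3`. The final
  -- constant is `9` because `15 · 5 ≤ 9²`.
  have h3 : w ^ 2 + 1 ≤ 15 * p ^ 2 := by
    have : v + z.re = w - (u - v) := by rw [hw]; ring
    rw [this] at h1
    nlinarith [sq_nonneg (w - 2 * (u - v)), mul_nonneg (sub_nonneg.2 hvu) (sub_nonneg.2 huv)]
  have h4 : (1 + w ^ 2) ^ 2 ≤ (9 * (p * q)) ^ 2 := by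
    have : (w ^ 2 + 1) * (w ^ 2 + 1) ≤ (15 * p ^ 2) * (5 * q ^ 2) :=
      mul_le_mul h3 h2 (by positivity) (by positivity)
    nlinarith [sq_nonneg (p * q)]
  have h5 : 1 + w ^ 2 ≤ 9 * (p * q) := abs_le_of_sq_le_sq' h4 (by positivity) |>.2
  calc (u - v) * (1 + w ^ 2) ≤ 1 * (1 + w ^ 2) := by
        gcongr; linarith
    _ ≤ 9 * (p * q) := by linarith

/-- The error of replacing a term by an integral over a unit interval is controlled by the primitive
of `9/(1 + (u + Re z)²)`. Increments of `arctan` telescope, so the total error is at most `9π`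
uniformly in `z`. -/
theorem norm_inv_sub_log_le {z : ℂ} (hz : z ∈ logRegion) {v : ℝ} (hv : 1 ≤ v) :
    ‖1 / ((v : ℂ) + z) - (Complex.log (((v + 1 : ℝ) : ℂ) + z) - Complex.log ((v : ℂ) + z))‖
      ≤ 9 * (Real.arctan (v + 1 + z.re) - Real.arctan (v + z.re)) := by
  have hd : ∀ u : ℝ, 1 ≤ u → HasDerivAt (fun u : ℝ => ((u - v : ℝ) : ℂ) * (1 / ((v : ℂ) + z))
      - (Complex.log ((u : ℂ) + z) - Complex.log ((v : ℂ) + z)))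
      (1 / ((v : ℂ) + z) - 1 / ((u : ℂ) + z)) u := by
    intro u hu
    have h1 : HasDerivAt (fun u : ℝ => ((u - v : ℝ) : ℂ)) 1 u := by
      simpa using ((hasDerivAt_id u).sub_const v).ofReal_comp
    have h2 : HasDerivAt (fun u : ℝ => (u : ℂ) + z) 1 u := by
      simpa using ((hasDerivAt_id u).ofReal_comp).add_const z
    have h3 := h2.clog_real (add_mem_slitPlane_of_mem hz hu)
    exact ((h1.mul_const (1 / ((v : ℂ) + z))).sub (h3.sub_const _)).congr_deriv (by rw [one_mul])
  have hB : ∀ u : ℝ, HasDerivAt (fun u : ℝ => 9 * (Real.arctan (u + z.re) - Real.arctan (v + z.re)))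
      (9 * (1 / (1 + (u + z.re) ^ 2))) u := by
    intro u
    have h2 : HasDerivAt (fun u : ℝ => u + z.re) 1 u := (hasDerivAt_id u).add_const _
    have := ((h2.arctan).sub_const (Real.arctan (v + z.re))).const_mul 9
    simpa using this
  have := image_norm_le_of_norm_deriv_right_le_deriv_boundary (a := v) (b := v + 1)
    (f := fun u : ℝ => ((u - v : ℝ) : ℂ) * (1 / ((v : ℂ) + z))
      - (Complex.log ((u : ℂ) + z) - Complex.log ((v : ℂ) + z)))
    (f' := fun u => 1 / ((v : ℂ) + z) - 1 / ((u : ℂ) + z))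
    (fun u hu => (hd u (hv.trans hu.1)).continuousAt.continuousWithinAt)
    (fun u hu => (hd u (hv.trans hu.1)).hasDerivWithinAt) (by simp) hB
    (fun u hu => norm_inv_sub_inv_le hz hv hu.1 hu.2.le)
    (Set.right_mem_Icc.2 (by linarith))
  simpa using this

theorem norm_harmSum_sub_log_le {z : ℂ} (hz : z ∈ logRegion) (n : ℕ) :
    ‖harmSum n z - (∑ k ∈ Finset.range n, 1 / ((k : ℂ) + 1)
      - (Complex.log (((n + 1 : ℝ) : ℂ) + z) - Complex.log (1 + z)))‖ ≤ 9 * Real.pi := by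
  have hs : ∀ n : ℕ, ‖harmSum n z - (∑ k ∈ Finset.range n, 1 / ((k : ℂ) + 1)
      - (Complex.log (((n + 1 : ℝ) : ℂ) + z) - Complex.log (1 + z)))‖
      ≤ 9 * (Real.arctan (n + 1 + z.re) - Real.arctan (1 + z.re)) := by
    intro n
    induction n with
    | zero => simp [harmSum]
    | succ n ih =>
      have h := norm_inv_sub_log_le hz (v := (n : ℝ) + 1) (by
        have : (0 : ℝ) ≤ n := n.cast_nonneg
        linarith)
      have e : harmSum (n + 1) z - (∑ k ∈ Finset.range (n + 1), 1 / ((k : ℂ) + 1)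
          - (Complex.log ((((n + 1 : ℕ) + 1 : ℝ) : ℂ) + z) - Complex.log (1 + z)))
        = (harmSum n z - (∑ k ∈ Finset.range n, 1 / ((k : ℂ) + 1)
          - (Complex.log (((n + 1 : ℝ) : ℂ) + z) - Complex.log (1 + z))))
          - (1 / ((((n : ℝ) + 1 : ℝ) : ℂ) + z) - (Complex.log ((((n : ℝ) + 1 + 1 : ℝ) : ℂ) + z)
            - Complex.log ((((n : ℝ) + 1 : ℝ) : ℂ) + z))) := by
        rw [harmSum, Finset.sum_range_succ, ← harmSum, Finset.sum_range_succ]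
        push_cast
        ring
      rw [e]
      refine (norm_sub_le _ _).trans ((add_le_add ih h).trans (le_of_eq ?_))
      push_cast
      ring
  refine (hs n).trans ?_
  have h1 := Real.arctan_lt_pi_div_two (n + 1 + z.re)
  have h2 := Real.neg_pi_div_two_lt_arctan (1 + z.re)
  linarith

theorem tendsto_log_natCast_add_sub_log (w : ℂ) :
    Tendsto (fun n : ℕ => Complex.log ((n : ℂ) + w) - (Real.log n : ℂ)) atTop (𝓝 0) := by
  have h1 : Tendsto (fun n : ℕ => 1 + w * ((n : ℂ))⁻¹) atTop (𝓝 1) := by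
    have : Tendsto (fun n : ℕ => ((n : ℂ))⁻¹) atTop (𝓝 0) := tendsto_inv_atTop_nhds_zero_nat
    simpa using (this.const_mul w).const_add 1
  have h2 := h1.clog (by simp)
  rw [Complex.log_one] at h2
  refine h2.congr' ?_
  have hne : ∀ᶠ n : ℕ in atTop, 1 + w * ((n : ℂ))⁻¹ ≠ 0 := h1.eventually_ne one_ne_zero
  filter_upwards [hne, eventually_gt_atTop 0] with n hn hpos
  have hn0 : (n : ℂ) ≠ 0 := by exact_mod_cast hpos.ne'
  rw [show (n : ℂ) + w = ((n : ℝ) : ℂ) * (1 + w * ((n : ℂ))⁻¹) by push_cast; field_simp,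
    Complex.log_ofReal_mul (by exact_mod_cast hpos) hn]
  ring

/-- The uniform bound on partial sums passes to the limit, where the harmonic numbers minus `log n`
leave `γ`; the summand `1` absorbs `γ`. -/
theorem norm_harm_sub_log_le {z : ℂ} (hz : z ∈ logRegion) :
    ‖harm z - Complex.log (1 + z)‖ ≤ 9 * Real.pi + 1 := by
  have h1 := tendsto_harmSum (one_add_mem_slitPlane_of_mem hz)
  have h2 := tendsto_log_natCast_add_sub_log (1 + z)
  have h3 : Tendsto (fun n : ℕ => (((harmonic n : ℚ) : ℝ) - Real.log n : ℝ)) atTop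
    (𝓝 Real.eulerMascheroniConstant) := Real.tendsto_harmonic_sub_log
  have h4 := (Complex.continuous_ofReal.tendsto _).comp h3
  have h5 := (h1.sub ((h4.sub h2).add_const (Complex.log (1 + z)))).norm
  have h6 : ‖harm z - ((Real.eulerMascheroniConstant : ℂ) - 0 + Complex.log (1 + z))‖
      ≤ 9 * Real.pi := by
    refine le_of_tendsto h5 (Eventually.of_forall fun n => ?_)
    refine le_trans (le_of_eq ?_) (norm_harmSum_sub_log_le hz n)
    congr 2
    simp only [Function.comp_apply, harmonic]
    push_cast
    rw [show (n : ℂ) + 1 + z = n + (1 + z) by ring]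
    simp only [one_div]
    ring
  have h7 : ‖(Real.eulerMascheroniConstant : ℂ)‖ ≤ 1 := by
    rw [Complex.norm_real, Real.norm_eq_abs, abs_of_pos
      (lt_trans (by norm_num) Real.one_half_lt_eulerMascheroniConstant)]
    linarith [Real.eulerMascheroniConstant_lt_two_thirds]
  calc ‖harm z - Complex.log (1 + z)‖
      = ‖(harm z - ((Real.eulerMascheroniConstant : ℂ) - 0 + Complex.log (1 + z)))
        + (Real.eulerMascheroniConstant : ℂ)‖ := by congr 1; ring
    _ ≤ 9 * Real.pi + 1 := (norm_add_le _ _).trans (add_le_add h6 h7)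

theorem log_norm_le_re_harm {z : ℂ} (hz : z ∈ logRegion) :
    Real.log ‖1 + z‖ - (9 * Real.pi + 1) ≤ (harm z).re := by
  have h := (Complex.abs_re_le_norm _).trans (norm_harm_sub_log_le hz)
  rw [Complex.sub_re, Complex.log_re] at h
  linarith [(abs_le.1 h).1]

theorem half_le_norm_one_add {z : ℂ} (hz : z ∈ logRegion) : 1 / 2 ≤ ‖1 + z‖ := by
  rcases hz with h | h
  · refine le_trans ?_ (Complex.re_le_norm _)
    simp; linarith
  · refine le_trans ?_ ((le_abs_self _).trans (Complex.abs_im_le_norm _))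
    simp; linarith

theorem norm_harm_le {z : ℂ} (hz : z ∈ logRegion) :
    ‖harm z‖ ≤ Real.log (2 * (1 + ‖z‖)) + (10 * Real.pi + 2) := by
  have h := norm_harm_sub_log_le hz
  have h1 := half_le_norm_one_add hz
  have h2 : ‖Complex.log (1 + z)‖ ≤ |Real.log ‖1 + z‖| + Real.pi := by
    refine (Complex.norm_le_abs_re_add_abs_im _).trans ?_
    rw [Complex.log_re, Complex.log_im]
    gcongr
    exact Complex.abs_arg_le_pi _
  have h3 : |Real.log ‖1 + z‖| ≤ Real.log (2 * (1 + ‖z‖)) := by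
    rw [abs_le]
    constructor
    · rw [neg_le, ← Real.log_inv]
      refine Real.log_le_log (by positivity) ?_
      rw [inv_le_comm₀ (by positivity) (by positivity)]
      refine le_trans ?_ h1
      rw [one_div]
      gcongr
      linarith [norm_nonneg z]
    · refine Real.log_le_log (by positivity) ?_
      have := norm_add_le (1 : ℂ) z
      rw [norm_one] at this
      linarith [norm_nonneg z]
  have h4 : ‖harm z‖ ≤ ‖harm z - Complex.log (1 + z)‖ + ‖Complex.log (1 + z)‖ := by
    simpa using norm_add_le (harm z - Complex.log (1 + z)) (Complex.log (1 + z))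
  linarith [Real.pi_pos]

theorem norm_exp_neg_mul_harm_le {z : ℂ} (hz : z ∈ logRegion) {a : ℝ} (ha : 0 ≤ a) :
    ‖Complex.exp (-(a : ℂ) * harm z)‖ ≤ Real.exp (a * (9 * Real.pi + 1)) * ‖1 + z‖ ^ (-a) := by
  have h := log_norm_le_re_harm hz
  have h1 := half_le_norm_one_add hz
  rw [Complex.norm_exp, Real.rpow_def_of_pos (by positivity), ← Real.exp_add]
  refine Real.exp_le_exp.2 ?_
  have e : (-(a : ℂ) * harm z).re = -a * (harm z).re := by
    rw [← Complex.ofReal_neg, Complex.re_ofReal_mul]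
  rw [e]
  nlinarith

/-! ### Polynomial growth. -/

/-- Continuity on `[0, ∞)` together with polynomial growth. -/
def PolyGrowth (f : ℝ → ℂ) : Prop :=
  ContinuousOn f (Set.Ici 0) ∧ ∃ C : ℝ, ∃ N : ℕ, ∀ t : ℝ, 0 ≤ t → ‖f t‖ ≤ C * (1 + t) ^ N

theorem PolyGrowth.exists_pos {f : ℝ → ℂ} (hf : PolyGrowth f) :
    ∃ C : ℝ, 0 < C ∧ ∃ N : ℕ, ∀ t : ℝ, 0 ≤ t → ‖f t‖ ≤ C * (1 + t) ^ N := by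
  obtain ⟨-, C, N, h⟩ := hf
  refine ⟨|C| + 1, by positivity, N, fun t ht => (h t ht).trans ?_⟩
  gcongr
  linarith [le_abs_self C]

theorem polyGrowth_const (w : ℂ) : PolyGrowth fun _ => w :=
  ⟨continuousOn_const, ‖w‖, 0, fun t _ => by simp⟩

theorem PolyGrowth.mul {f g : ℝ → ℂ} (hf : PolyGrowth f) (hg : PolyGrowth g) :
    PolyGrowth fun t => f t * g t := by
  obtain ⟨C, hC, N, h⟩ := hf.exists_pos
  obtain ⟨D, hD, M, k⟩ := hg.exists_pos
  refine ⟨hf.1.mul hg.1, C * D, N + M, fun t ht => ?_⟩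
  rw [norm_mul, pow_add, mul_mul_mul_comm]
  exact mul_le_mul (h t ht) (k t ht) (norm_nonneg _) (by positivity)

theorem PolyGrowth.add {f g : ℝ → ℂ} (hf : PolyGrowth f) (hg : PolyGrowth g) :
    PolyGrowth fun t => f t + g t := by
  obtain ⟨C, hC, N, h⟩ := hf.exists_pos
  obtain ⟨D, hD, M, k⟩ := hg.exists_pos
  refine ⟨hf.1.add hg.1, C + D, N + M, fun t ht => ?_⟩
  rw [add_mul]
  refine (norm_add_le _ _).trans (add_le_add ((h t ht).trans ?_) ((k t ht).trans ?_))
  · gcongr <;> linarith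
  · gcongr <;> linarith

theorem PolyGrowth.pow {f : ℝ → ℂ} (hf : PolyGrowth f) (n : ℕ) : PolyGrowth fun t => f t ^ n := by
  induction n with
  | zero => simpa using polyGrowth_const 1
  | succ n ih => simpa [pow_succ] using ih.mul hf

theorem integrableOn_one_add_pow_mul_exp (N : ℕ) {y : ℝ} (hy : 0 < y) :
    IntegrableOn (fun t : ℝ => (1 + t) ^ N * Real.exp (-(y * t))) (Set.Ioi 0) := by
  refine integrable_of_isBigO_exp_neg (b := y / 2) (by positivity) (by fun_prop) ?_
  have h1 : (fun t : ℝ => (1 + t) ^ N) =O[atTop] fun t => Real.exp (y / 2 * t) := by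
    have h2 : (fun t : ℝ => (1 + t)) =O[atTop] fun t => t := by
      refine Asymptotics.IsBigO.of_bound 2 ?_
      filter_upwards [eventually_ge_atTop 1] with t ht
      rw [Real.norm_of_nonneg (by linarith), Real.norm_of_nonneg (by linarith)]
      linarith
    exact (h2.pow N).trans (isLittleO_pow_exp_pos_mul_atTop N (by positivity)).isBigO
  refine (h1.mul (Asymptotics.isBigO_refl (fun t => Real.exp (-(y * t))) atTop)).congr_right ?_
  intro t
  rw [← Real.exp_add]
  congr 1
  ring

/-! ### The half Hankel contour and growth along it. -/

/-- The half Hankel contour: up from `c` to `c + i`, then left to `-∞ + i`. -/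
noncomputable def hankelPath (c t : ℝ) : ℂ := ⟨c - max (t - 1) 0, min t 1⟩

/-- The direction in which `hankelPath` is traversed. -/
noncomputable def hankelDir (t : ℝ) : ℂ := if t ≤ 1 then Complex.I else -1

/-- The integral of `e^{z y} A(z)` along the half Hankel contour from `c`. -/
noncomputable def hankel (c : ℝ) (A : ℂ → ℂ) (y : ℝ) : ℂ :=
  ∫ t in Set.Ioi (0 : ℝ), hankelDir t * (Complex.exp (hankelPath c t * y) * A (hankelPath c t))

theorem hankelPath_of_le {t : ℝ} (c : ℝ) (ht : t ≤ 1) : hankelPath c t = c + t * Complex.I := by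
  apply Complex.ext <;> simp [hankelPath, ht]

theorem hankelPath_of_ge {t : ℝ} (c : ℝ) (ht : 1 ≤ t) :
    hankelPath c t = ((c + 1 - t : ℝ) : ℂ) + Complex.I := by
  apply Complex.ext
  · simp [hankelPath, ht]; ring
  · simp [hankelPath, ht]

theorem continuous_hankelPath (c : ℝ) : Continuous (hankelPath c) := by
  have : hankelPath c = fun t => ((c - max (t - 1) 0 : ℝ) : ℂ) + ((min t 1 : ℝ) : ℂ) * Complex.I := by
    ext t
    apply Complex.ext <;> simp [hankelPath]
  rw [this]
  fun_prop

theorem norm_hankelDir (t : ℝ) : ‖hankelDir t‖ = 1 := by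
  unfold hankelDir
  split_ifs <;> simp

theorem measurable_hankelDir : Measurable hankelDir :=
  Measurable.ite measurableSet_Iic measurable_const measurable_const

theorem hankelPath_mem_logRegion {c : ℝ} (hc : -(1 / 2) ≤ c) (t : ℝ) :
    hankelPath c t ∈ logRegion := by
  rcases le_total t 1 with h | h
  · left
    simp [hankelPath, h]
    linarith
  · right
    simp [hankelPath, h]

theorem norm_hankelPath_le (c : ℝ) {t : ℝ} (ht : 0 ≤ t) :
    ‖hankelPath c t‖ ≤ (|c| + 1) * (1 + t) := by
  refine (Complex.norm_le_abs_re_add_abs_im _).trans ?_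
  simp only [hankelPath]
  have h1 : |c - max (t - 1) 0| ≤ |c| + t := by
    refine (abs_sub _ _).trans ?_
    rw [abs_of_nonneg (le_max_right (t - 1) 0)]
    gcongr
    exact max_le (by linarith) ht
  have h2 : |min t 1| ≤ 1 := by
    rw [abs_of_nonneg (le_min ht zero_le_one)]
    exact min_le_right _ _
  nlinarith [abs_nonneg c]

theorem le_norm_hankelPath (c t : ℝ) : min c 1 ≤ ‖hankelPath c t‖ := by
  rcases le_total t 1 with h | h
  · refine (min_le_left _ _).trans (le_trans ?_ (Complex.re_le_norm _))
    simp [hankelPath, h]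
  · refine (min_le_right _ _).trans (le_trans ?_ ((le_abs_self _).trans (Complex.abs_im_le_norm _)))
    simp [hankelPath, h]

theorem hankelPath_ne_zero {c t : ℝ} (hc : 0 < c) : hankelPath c t ≠ 0 :=
  norm_pos_iff.1 ((lt_min hc one_pos).trans_le (le_norm_hankelPath c _))

theorem polyGrowth_hankelPath (c : ℝ) : PolyGrowth (hankelPath c) :=
  ⟨(continuous_hankelPath c).continuousOn, |c| + 1, 1, fun t ht => by
    simpa using norm_hankelPath_le c ht⟩

theorem polyGrowth_inv_hankelPath {c : ℝ} (hc : 0 < c) :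
    PolyGrowth fun t => (hankelPath c t)⁻¹ :=
  ⟨(continuous_hankelPath c).continuousOn.inv₀ fun _ _ => hankelPath_ne_zero hc, (min c 1)⁻¹, 0,
    fun t _ => by
      rw [norm_inv, pow_zero, mul_one]
      exact inv_anti₀ (lt_min hc one_pos) (le_norm_hankelPath c _)⟩

theorem continuousOn_comp_hankelPath {c : ℝ} {A : ℂ → ℂ} (hc : -(1 / 2) ≤ c)
    (hA : ∀ z ∈ logRegion, ContinuousAt A z) : Continuous fun t => A (hankelPath c t) :=
  continuous_iff_continuousAt.2 fun t =>
    ContinuousAt.comp (hA _ (hankelPath_mem_logRegion hc t)) (continuous_hankelPath c).continuousAt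

/-- `H` grows only logarithmically, so its exponentials stay polynomial and the factor `e^{zy}`
dominates them. This is what later permits termwise integration of the exponential series for every
`a`. -/
theorem exists_exp_mul_norm_harm_le {c : ℝ} (hc : -(1 / 2) ≤ c) {b : ℝ} (hb : 0 ≤ b) :
    ∃ C : ℝ, 0 < C ∧ ∃ N : ℕ, ∀ t : ℝ, 0 ≤ t →
      Real.exp (b * ‖harm (hankelPath c t)‖) ≤ C * (1 + t) ^ N := by
  obtain ⟨N, hN⟩ := exists_nat_ge b
  refine ⟨Real.exp (N * (10 * Real.pi + 2)) * (2 * (|c| + 2)) ^ N, by positivity, N,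
    fun t ht => ?_⟩
  have h1 := norm_harm_le (hankelPath_mem_logRegion hc t)
  have h2 := norm_hankelPath_le c ht
  have h3 : (0 : ℝ) < 2 * (1 + ‖hankelPath c t‖) := by positivity
  calc Real.exp (b * ‖harm (hankelPath c t)‖)
      ≤ Real.exp (N * (Real.log (2 * (1 + ‖hankelPath c t‖)) + (10 * Real.pi + 2))) := by
        refine Real.exp_le_exp.2 ?_
        exact mul_le_mul hN h1 (norm_nonneg _) (hb.trans hN)
    _ = Real.exp (N * (10 * Real.pi + 2)) * (2 * (1 + ‖hankelPath c t‖)) ^ N := by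
        rw [mul_add, Real.exp_add, Real.exp_nat_mul _ N, Real.exp_log h3, mul_comm]
    _ ≤ Real.exp (N * (10 * Real.pi + 2)) * (2 * (|c| + 2) * (1 + t)) ^ N := by
        gcongr ?_ * ?_ ^ _
        nlinarith [abs_nonneg c]
    _ = _ := by rw [mul_pow]; ring

theorem polyGrowth_harm {c : ℝ} (hc : -(1 / 2) ≤ c) : PolyGrowth fun t => harm (hankelPath c t) := by
  obtain ⟨C, hC, N, h⟩ := exists_exp_mul_norm_harm_le hc zero_le_one
  refine ⟨(continuousOn_comp_hankelPath hc fun z hz =>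
    (differentiableAt_harm (one_add_mem_slitPlane_of_mem hz)).continuousAt).continuousOn, C, N,
    fun t ht => le_trans ?_ (h t ht)⟩
  rw [one_mul]
  linarith [Real.add_one_le_exp ‖harm (hankelPath c t)‖]

theorem polyGrowth_exp_harm {c : ℝ} (hc : -(1 / 2) ≤ c) (a : ℂ) :
    PolyGrowth fun t => Complex.exp (a * harm (hankelPath c t)) := by
  obtain ⟨C, hC, N, h⟩ := exists_exp_mul_norm_harm_le hc (norm_nonneg a)
  refine ⟨(Complex.continuous_exp.comp_continuousOn
    (continuousOn_const.mul (polyGrowth_harm hc).1)), C, N, fun t ht => le_trans ?_ (h t ht)⟩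
  refine (Complex.norm_exp_le_exp_norm _).trans ?_
  rw [norm_mul]

theorem norm_exp_hankelPath_mul_le (c t : ℝ) {y : ℝ} (hy : 0 ≤ y) :
    ‖Complex.exp (hankelPath c t * y)‖ ≤ Real.exp (y * (c + 1)) * Real.exp (-(y * t)) := by
  rw [Complex.norm_exp, ← Real.exp_add, Complex.re_mul_ofReal]
  refine Real.exp_le_exp.2 ?_
  simp only [hankelPath]
  nlinarith [mul_le_mul_of_nonneg_left (le_max_left (t - 1) 0) hy]

/-! ### Integrals along the half Hankel contour and their deformation. -/

theorem aestronglyMeasurable_hankel {c : ℝ} {A : ℂ → ℂ}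
    (hA : PolyGrowth fun t => A (hankelPath c t)) (y : ℝ) :
    AEStronglyMeasurable
      (fun t => hankelDir t * (Complex.exp (hankelPath c t * y) * A (hankelPath c t)))
      (volume.restrict (Set.Ioi 0)) := by
  refine measurable_hankelDir.aestronglyMeasurable.mul ?_
  refine ContinuousOn.aestronglyMeasurable (ContinuousOn.mul ?_ (hA.1.mono Set.Ioi_subset_Ici_self))
    measurableSet_Ioi
  exact (Complex.continuous_exp.comp
    ((continuous_hankelPath c).mul continuous_const)).continuousOn

theorem integrableOn_hankel {c : ℝ} {A : ℂ → ℂ}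
    (hA : PolyGrowth fun t => A (hankelPath c t)) {y : ℝ} (hy : 0 < y) :
    IntegrableOn (fun t => hankelDir t * (Complex.exp (hankelPath c t * y) * A (hankelPath c t)))
      (Set.Ioi 0) := by
  obtain ⟨C, hC, N, h⟩ := hA.exists_pos
  refine Integrable.mono' (((integrableOn_one_add_pow_mul_exp N hy).const_mul
    (Real.exp (y * (c + 1)) * C))) (aestronglyMeasurable_hankel hA y) ?_
  refine (ae_restrict_iff' measurableSet_Ioi).2 (Eventually.of_forall fun t ht => ?_)
  rw [norm_mul, norm_hankelDir, one_mul, norm_mul]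
  calc _ ≤ (Real.exp (y * (c + 1)) * Real.exp (-(y * t))) * (C * (1 + t) ^ N) :=
        mul_le_mul (norm_exp_hankelPath_mul_le c t hy.le) (h t (le_of_lt ht)) (norm_nonneg _)
          (by positivity)
    _ = _ := by ring

theorem hasDerivAt_hankel {c : ℝ} {A : ℂ → ℂ}
    (hA : PolyGrowth fun t => A (hankelPath c t)) {y : ℝ} (hy : 0 < y) :
    HasDerivAt (hankel c A) (hankel c (fun z => z * A z) y) y := by
  have hzA : PolyGrowth fun t => hankelPath c t * A (hankelPath c t) :=
    (polyGrowth_hankelPath c).mul hA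
  obtain ⟨C, hC, N, h⟩ := hzA.exists_pos
  refine (hasDerivAt_integral_of_dominated_loc_of_deriv_le
    (μ := volume.restrict (Set.Ioi (0 : ℝ))) (x₀ := y) (s := Set.Ioo (y / 2) (2 * y))
    (F := fun y t => hankelDir t * (Complex.exp (hankelPath c t * (y : ℝ)) * A (hankelPath c t)))
    (F' := fun y t => hankelDir t * (Complex.exp (hankelPath c t * (y : ℝ))
      * (hankelPath c t * A (hankelPath c t))))
    (bound := fun t => Real.exp (2 * y * (|c| + 1)) * C
      * ((1 + t) ^ N * Real.exp (-(y / 2 * t))))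
    (Ioo_mem_nhds (by linarith) (by linarith))
    (Eventually.of_forall fun x => aestronglyMeasurable_hankel hA x)
    (integrableOn_hankel hA hy) (aestronglyMeasurable_hankel (A := fun z => z * A z) hzA y) ?_
    ((integrableOn_one_add_pow_mul_exp N (by positivity)).const_mul _) ?_).2
  · refine (ae_restrict_iff' measurableSet_Ioi).2 (Eventually.of_forall fun t ht x hx => ?_)
    have ht0 : (0 : ℝ) < t := ht
    have hx0 : 0 < x := (by linarith : (0 : ℝ) < y / 2).trans hx.1
    rw [norm_mul, norm_hankelDir, one_mul, norm_mul]
    have h1 := norm_exp_hankelPath_mul_le c t hx0.le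
    have h2 : Real.exp (x * (c + 1)) ≤ Real.exp (2 * y * (|c| + 1)) := by
      refine Real.exp_le_exp.2 ?_
      have : c ≤ |c| := le_abs_self c
      calc x * (c + 1) ≤ x * (|c| + 1) := by gcongr
        _ ≤ 2 * y * (|c| + 1) := by
          have := hx.2.le
          gcongr
    have h3 : Real.exp (-(x * t)) ≤ Real.exp (-(y / 2 * t)) := by
      refine Real.exp_le_exp.2 (neg_le_neg ?_)
      have := hx.1.le
      gcongr
    calc _ ≤ (Real.exp (2 * y * (|c| + 1)) * Real.exp (-(y / 2 * t))) * (C * (1 + t) ^ N) :=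
          mul_le_mul (h1.trans (mul_le_mul h2 h3 (by positivity) (by positivity)))
            (h t ht0.le) (norm_nonneg _) (by positivity)
      _ = _ := by ring
  · refine Eventually.of_forall fun t x _ => ?_
    have h1 : HasDerivAt (fun x : ℝ => hankelPath c t * (x : ℂ)) (hankelPath c t) x := by
      simpa using ((hasDerivAt_id x).ofReal_comp).const_mul (hankelPath c t)
    refine ((h1.cexp.mul_const (A (hankelPath c t))).const_mul (hankelDir t)).congr_deriv ?_
    ring

theorem hankel_add {c : ℝ} {A B : ℂ → ℂ} (hA : PolyGrowth fun t => A (hankelPath c t))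
    (hB : PolyGrowth fun t => B (hankelPath c t)) {y : ℝ} (hy : 0 < y) :
    hankel c (fun z => A z + B z) y = hankel c A y + hankel c B y := by
  unfold hankel
  rw [← integral_add (integrableOn_hankel hA hy) (integrableOn_hankel hB hy)]
  congr 1
  ext t
  ring

theorem hankel_const_mul (c : ℝ) (A : ℂ → ℂ) (w : ℂ) (y : ℝ) :
    hankel c (fun z => w * A z) y = w * hankel c A y := by
  unfold hankel
  rw [← integral_const_mul]
  congr 1
  ext t
  ring

theorem hankel_congr {c : ℝ} {A B : ℂ → ℂ} (h : ∀ t, 0 < t → A (hankelPath c t) = B (hankelPath c t))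
    (y : ℝ) : hankel c A y = hankel c B y := by
  unfold hankel
  refine setIntegral_congr_fun measurableSet_Ioi fun t ht => ?_
  simp only [h t ht]

/-- Splits the contour at its corner; the reflection `x = c + 1 - t` turns the leftward ray into an
integral over `(-∞, c]`, the form needed for Cauchy's theorem on rectangles. -/
theorem hankel_eq {c : ℝ} {A : ℂ → ℂ} (hA : PolyGrowth fun t => A (hankelPath c t)) {y : ℝ}
    (hy : 0 < y) :
    IntegrableOn (fun x : ℝ => Complex.exp ((x + Complex.I) * y) * A (x + Complex.I)) (Set.Iic c) ∧
    hankel c A y = Complex.I * (∫ t in (0 : ℝ)..1, Complex.exp ((c + t * Complex.I) * y)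
        * A (c + t * Complex.I))
      - ∫ x in Set.Iic c, Complex.exp ((x + Complex.I) * y) * A (x + Complex.I) := by
  have hint := integrableOn_hankel hA hy
  have h1 : ∫ t in Set.Ioi (1 : ℝ), hankelDir t * (Complex.exp (hankelPath c t * y)
      * A (hankelPath c t)) = ∫ t in Set.Ioi (1 : ℝ), -(Complex.exp ((((c + 1 - t : ℝ) : ℂ)
        + Complex.I) * y) * A (((c + 1 - t : ℝ) : ℂ) + Complex.I)) := by
    refine setIntegral_congr_fun measurableSet_Ioi fun t ht => ?_
    have ht' : (1 : ℝ) < t := ht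
    simp only [hankelPath_of_ge c ht'.le, hankelDir, not_le.2 ht', if_false]
    ring
  set G : ℝ → ℂ := fun x => Complex.exp ((x + Complex.I) * y) * A (x + Complex.I) with hG
  have hmp : MeasurePreserving (fun t : ℝ => c + 1 - t) volume volume :=
    Measure.measurePreserving_sub_left volume (c + 1)
  have hme : MeasurableEmbedding (fun t : ℝ => c + 1 - t) :=
    (Homeomorph.subLeft (c + 1)).measurableEmbedding
  have hpre : (fun t : ℝ => c + 1 - t) ⁻¹' (Set.Iic c) = Set.Ici 1 := by
    ext t
    simp only [Set.mem_preimage, Set.mem_Iic, Set.mem_Ici]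
    constructor <;> intro h <;> linarith
  constructor
  · rw [← hmp.integrableOn_comp_preimage hme, hpre, integrableOn_Ici_iff_integrableOn_Ioi]
    refine ((hint.mono_set (Set.Ioi_subset_Ioi zero_le_one)).neg).congr ?_
    refine (ae_restrict_iff' measurableSet_Ioi).2 (Eventually.of_forall fun t ht => ?_)
    have ht' : (1 : ℝ) < t := ht
    simp only [Pi.neg_apply, hankelPath_of_ge c ht'.le, hankelDir, not_le.2 ht', if_false, hG,
      Function.comp_apply]
    ring
  · have h2 : ∫ t in Set.Ioi (1 : ℝ), -(G (c + 1 - t)) = -∫ x in Set.Iic c, G x := by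
      rw [integral_neg, ← hmp.setIntegral_preimage_emb hme G (Set.Iic c), hpre, integral_Ici_eq_integral_Ioi]
    have h3 : ∫ t in Set.Ioc (0 : ℝ) 1, hankelDir t * (Complex.exp (hankelPath c t * y)
        * A (hankelPath c t)) = Complex.I * (∫ t in (0 : ℝ)..1,
          Complex.exp ((c + t * Complex.I) * y) * A (c + t * Complex.I)) := by
      rw [intervalIntegral.integral_of_le zero_le_one, ← integral_const_mul]
      refine setIntegral_congr_fun measurableSet_Ioc fun t ht => ?_
      simp only [hankelPath_of_le c ht.2, hankelDir, ht.2, if_true]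
    unfold hankel
    rw [← Set.Ioc_union_Ioi_eq_Ioi (zero_le_one (α := ℝ)), setIntegral_union
      Set.Ioc_disjoint_Ioi_same measurableSet_Ioi (hint.mono_set Set.Ioc_subset_Ioi_self)
      (hint.mono_set (Set.Ioi_subset_Ioi zero_le_one)), h1, h3, sub_eq_add_neg]
    congr 1

theorem hankelPath_of_iic {c x : ℝ} (hx : x ≤ c) : hankelPath c (c + 1 - x) = x + Complex.I := by
  rw [hankelPath_of_ge c (by linarith)]
  congr 2
  ring

theorem continuousOn_vertical {c : ℝ} {A : ℂ → ℂ} (hA : PolyGrowth fun t => A (hankelPath c t))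
    (y : ℝ) : ContinuousOn (fun t : ℝ => Complex.exp ((c + t * Complex.I) * y)
      * A (c + t * Complex.I)) (Set.Icc 0 1) := by
  refine ContinuousOn.mul (by fun_prop) ((hA.1.mono Set.Icc_subset_Ici_self).congr ?_)
  intro t ht
  simp only [hankelPath_of_le c ht.2]

/-- Integrating a derivative along the half Hankel contour. -/
theorem hankel_deriv {c : ℝ} {B B' : ℂ → ℂ} (hB : PolyGrowth fun t => B (hankelPath c t))
    (hB' : PolyGrowth fun t => B' (hankelPath c t))
    (hd : ∀ t : ℝ, 0 ≤ t → HasDerivAt B (B' (hankelPath c t)) (hankelPath c t)) {y : ℝ}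
    (hy : 0 < y) :
    hankel c (fun z => y * B z + B' z) y = -(Complex.exp (c * y) * B c) := by
  have hF : PolyGrowth fun t => (y : ℂ) * B (hankelPath c t) + B' (hankelPath c t) :=
    ((polyGrowth_const _).mul hB).add hB'
  obtain ⟨h1, h2⟩ := hankel_eq (A := fun z => y * B z + B' z) hF hy
  obtain ⟨h3, -⟩ := hankel_eq hB hy
  have hde : ∀ w : ℂ, HasDerivAt B (B' w) w → HasDerivAt (fun z => Complex.exp (z * y) * B z)
      (Complex.exp (w * y) * (y * B w + B' w)) w := by
    intro w hw
    have : HasDerivAt (fun z : ℂ => z * (y : ℂ)) (y : ℂ) w := by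
      simpa using (hasDerivAt_id w).mul_const (y : ℂ)
    refine (this.cexp.mul hw).congr_deriv ?_
    ring
  have hv : ∫ t in (0 : ℝ)..1, Complex.I * (Complex.exp ((c + t * Complex.I) * y)
      * (y * B (c + t * Complex.I) + B' (c + t * Complex.I)))
      = Complex.exp ((c + Complex.I) * y) * B (c + Complex.I) - Complex.exp (c * y) * B c := by
    have := intervalIntegral.integral_eq_sub_of_hasDerivAt (a := (0 : ℝ)) (b := 1)
      (f := fun t : ℝ => Complex.exp ((c + t * Complex.I) * y) * B (c + t * Complex.I))
      (f' := fun t : ℝ => Complex.I * (Complex.exp ((c + t * Complex.I) * y)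
      * (y * B (c + t * Complex.I) + B' (c + t * Complex.I)))) ?_ ?_
    · rw [this]
      simp
    · intro t ht
      rw [Set.uIcc_of_le zero_le_one] at ht
      have h5 := hd t ht.1
      rw [hankelPath_of_le c ht.2] at h5
      have h6 : HasDerivAt (fun t : ℝ => (c : ℂ) + t * Complex.I) Complex.I t := by
        simpa using (((hasDerivAt_id t).ofReal_comp).mul_const Complex.I).const_add (c : ℂ)
      refine ((hde _ h5).comp t h6).congr_deriv ?_
      ring
    · refine ContinuousOn.intervalIntegrable ?_
      rw [Set.uIcc_of_le zero_le_one]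
      exact continuousOn_const.mul (continuousOn_vertical (A := fun z => y * B z + B' z) hF y)
  have hhd : ∀ x ∈ Set.Iic c, HasDerivAt (fun x : ℝ => Complex.exp ((x + Complex.I) * y)
      * B (x + Complex.I)) (Complex.exp ((x + Complex.I) * y) * (y * B (x + Complex.I)
        + B' (x + Complex.I))) x := by
    intro x hx
    have hx' : x ≤ c := hx
    have h5 := hd (c + 1 - x) (by linarith)
    rw [hankelPath_of_iic hx'] at h5
    have h6 : HasDerivAt (fun x : ℝ => (x : ℂ) + Complex.I) 1 x := by
      simpa using ((hasDerivAt_id x).ofReal_comp).add_const Complex.I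
    refine ((hde _ h5).comp x h6).congr_deriv ?_
    ring
  have hh := integral_Iic_of_hasDerivAt_of_tendsto' hhd h1
    (tendsto_zero_of_hasDerivAt_of_integrableOn_Iic hhd h1 h3)
  rw [h2, hh, ← intervalIntegral.integral_const_mul, hv]
  ring

/-- Cauchy's theorem on the rectangle with corners `c` and `c' + i`. The two contours differ by the
integral over the bottom side, where the integrand is real; hence only the imaginary part is
invariant. -/
theorem hankel_im_eq_of_le {c c' : ℝ} (hcc : c ≤ c') {A : ℂ → ℂ}
    (hA : PolyGrowth fun t => A (hankelPath c t)) (hA' : PolyGrowth fun t => A (hankelPath c' t))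
    (hd : ∀ z : ℂ, c ≤ z.re → 0 ≤ z.im → DifferentiableAt ℂ A z)
    (hr : ∀ x : ℝ, c ≤ x → (A x).im = 0) {y : ℝ} (hy : 0 < y) :
    (hankel c A y).im = (hankel c' A y).im := by
  obtain ⟨h1, h2⟩ := hankel_eq hA hy
  obtain ⟨h1', h2'⟩ := hankel_eq hA' hy
  set F : ℂ → ℂ := fun z => Complex.exp (z * y) * A z with hF
  have hrect := Complex.integral_boundary_rect_eq_zero_of_differentiableOn F c (c' + Complex.I) (by
    intro z hz
    have hz1 := hz.1
    have hz2 := hz.2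
    simp only [Complex.ofReal_re, Complex.ofReal_im, Complex.add_re, Complex.add_im, Complex.I_re,
      Complex.I_im, add_zero, zero_add, Set.mem_preimage, Set.uIcc_of_le hcc,
      Set.uIcc_of_le (zero_le_one (α := ℝ))] at hz1 hz2
    have := hd z hz1.1 hz2.1
    exact (((differentiableAt_id.mul_const _).cexp).mul this).differentiableWithinAt)
  simp only [Complex.ofReal_re, Complex.ofReal_im, Complex.add_re, Complex.add_im, Complex.I_re,
    Complex.I_im, add_zero, zero_add, Complex.ofReal_zero, Complex.ofReal_one, zero_mul, one_mul,
    smul_eq_mul] at hrect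
  have hreal : (∫ x in c..c', F x).im = 0 := by
    have : ∫ x in c..c', F x = ∫ x in c..c', (((F x).re : ℝ) : ℂ) := by
      refine intervalIntegral.integral_congr fun x hx => ?_
      rw [Set.uIcc_of_le hcc] at hx
      apply Complex.ext
      · simp
      · have e : Complex.exp ((x : ℂ) * y) = ((Real.exp (x * y) : ℝ) : ℂ) := by push_cast; rfl
        simp only [hF, e, Complex.im_ofReal_mul, hr x hx.1, mul_zero, Complex.ofReal_im]
    rw [this, intervalIntegral.integral_ofReal, Complex.ofReal_im]
  have hsplit : (∫ x in Set.Iic c', F (x + Complex.I)) - ∫ x in Set.Iic c, F (x + Complex.I)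
      = ∫ x in c..c', F (x + Complex.I) :=
    intervalIntegral.integral_Iic_sub_Iic h1 h1'
  have : hankel c' A y = hankel c A y - ∫ x in c..c', F x := by
    rw [h2, h2']
    linear_combination hrect - hsplit
  rw [this, Complex.sub_im, hreal, sub_zero]

/-- The integral along the vertical ray from `c` converges to the one along the half Hankel
contour. -/
theorem tendsto_vertical_hankel {c : ℝ} {A : ℂ → ℂ} (hA : PolyGrowth fun t => A (hankelPath c t))
    (hd : ∀ z : ℂ, 1 ≤ z.im → DifferentiableAt ℂ A z) {C b : ℝ} (hb : 0 < b)
    (hbd : ∀ z : ℂ, 1 ≤ z.im → ‖A z‖ ≤ C * z.im ^ (-b)) {y : ℝ} (hy : 0 < y) :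
    Tendsto (fun T : ℝ => Complex.I * ∫ t in (0 : ℝ)..T, Complex.exp ((c + t * Complex.I) * y)
      * A (c + t * Complex.I)) atTop (𝓝 (hankel c A y)) := by
  obtain ⟨h1, h2⟩ := hankel_eq hA hy
  set F : ℂ → ℂ := fun z => Complex.exp (z * y) * A z with hF
  have hFd : ∀ z : ℂ, 1 ≤ z.im → DifferentiableAt ℂ F z := fun z hz =>
    ((differentiableAt_id.mul_const _).cexp).mul (hd z hz)
  have hC : 0 ≤ C := by
    have := (norm_nonneg _).trans (hbd Complex.I (by simp))
    simpa using this
  have hFn : ∀ x T : ℝ, 1 ≤ T → ‖F (x + T * Complex.I)‖ ≤ C * T ^ (-b) * Real.exp (y * x) := by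
    intro x T hT
    have := hbd (x + T * Complex.I) (by simpa using hT)
    simp only [Complex.add_im, Complex.ofReal_im, Complex.mul_im, Complex.ofReal_re, Complex.I_im,
      mul_one, Complex.I_re, mul_zero, add_zero, zero_add] at this
    simp only [hF]
    rw [norm_mul, Complex.norm_exp, Complex.re_mul_ofReal, mul_comm]
    refine mul_le_mul this (le_of_eq ?_) (by positivity) (by positivity)
    simp [mul_comm]
  have hFc : ∀ T : ℝ, 1 ≤ T → Continuous fun x : ℝ => F (x + T * Complex.I) := by
    intro T hT
    refine continuous_iff_continuousAt.2 fun x => ?_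
    refine ContinuousAt.comp (f := fun x : ℝ => (x : ℂ) + T * Complex.I)
      (hFd _ (by simpa using hT)).continuousAt (by fun_prop)
  have hFi : ∀ T : ℝ, 1 ≤ T → IntegrableOn (fun x : ℝ => F (x + T * Complex.I)) (Set.Iic c) :=
    fun T hT => Integrable.mono' ((integrableOn_exp_mul_Iic hy c).const_mul (C * T ^ (-b)))
      (hFc T hT).aestronglyMeasurable (Eventually.of_forall fun x => hFn x T hT)
  have hFv : ∀ x : ℝ, ContinuousOn (fun t : ℝ => F (x + t * Complex.I)) (Set.Ici 1) := by
    intro x t ht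
    exact (ContinuousAt.comp (f := fun t : ℝ => (x : ℂ) + t * Complex.I)
      (hFd _ (by simpa using ht)).continuousAt (by fun_prop)).continuousWithinAt
  -- Cauchy's theorem on `[N, c] × [1, T]` with `N → -∞`: the left side vanishes through `e^{yN}`,
  -- leaving the ray at height `T`, which vanishes later through `T^{-b}`.
  have key : ∀ T : ℝ, 1 ≤ T → Complex.I * ∫ t in (0 : ℝ)..T, F (c + t * Complex.I)
      = hankel c A y + ∫ x in Set.Iic c, F (x + T * Complex.I) := by
    intro T hT
    have hrect : ∀ N : ℝ, N ≤ c → (∫ x in N..c, F (x + Complex.I))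
        - (∫ x in N..c, F (x + T * Complex.I)) + Complex.I * (∫ t in (1 : ℝ)..T,
          F (c + t * Complex.I)) - Complex.I * (∫ t in (1 : ℝ)..T, F (N + t * Complex.I)) = 0 := by
      intro N hN
      have := Complex.integral_boundary_rect_eq_zero_of_differentiableOn F (N + Complex.I)
        (c + T * Complex.I) (by
          intro z hz
          have hz2 := hz.2
          simp [Set.uIcc_of_le hT] at hz2
          exact (hFd z hz2.1).differentiableWithinAt)
      simpa using this
    have l1 := intervalIntegral_tendsto_integral_Iic c h1 tendsto_id
    have l2 := intervalIntegral_tendsto_integral_Iic c (hFi T hT) tendsto_id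
    have l3 : Tendsto (fun N : ℝ => ∫ t in (1 : ℝ)..T, F (N + t * Complex.I)) atBot (𝓝 0) := by
      have hz : Tendsto (fun N : ℝ => C * Real.exp (y * N) * |T - 1|) atBot (𝓝 0) := by
        have : Tendsto (fun N : ℝ => Real.exp (y * N)) atBot (𝓝 0) :=
          Real.tendsto_exp_atBot.comp (tendsto_id.const_mul_atBot hy)
        simpa using (this.const_mul C).mul_const |T - 1|
      refine squeeze_zero_norm (fun N => ?_) hz
      refine intervalIntegral.norm_integral_le_of_norm_le_const fun t ht => ?_
      rw [Set.uIoc_of_le hT] at ht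
      refine (hFn N t ht.1.le).trans ?_
      have : t ^ (-b) ≤ 1 := Real.rpow_le_one_of_one_le_of_nonpos ht.1.le (by linarith)
      calc C * t ^ (-b) * Real.exp (y * N) ≤ C * 1 * Real.exp (y * N) := by gcongr
        _ = _ := by ring
    have l4 := ((l1.sub l2).add_const (Complex.I * (∫ t in (1 : ℝ)..T,
          F (c + t * Complex.I)))).sub (l3.const_mul Complex.I)
    have l5 := tendsto_nhds_unique l4 (tendsto_const_nhds.congr' (by
      filter_upwards [eventually_le_atBot c] with N hN
      exact (hrect N hN).symm))
    have hadd : ∫ t in (0 : ℝ)..T, F (c + t * Complex.I) = (∫ t in (0 : ℝ)..1, F (c + t * Complex.I))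
        + ∫ t in (1 : ℝ)..T, F (c + t * Complex.I) := by
      refine (intervalIntegral.integral_add_adjacent_intervals ?_ ?_).symm
      · refine ContinuousOn.intervalIntegrable ?_
        rw [Set.uIcc_of_le zero_le_one]
        exact continuousOn_vertical hA y
      · refine ContinuousOn.intervalIntegrable ((hFv c).mono ?_)
        rw [Set.uIcc_of_le hT]
        exact Set.Icc_subset_Ici_self
    rw [hadd, h2]
    linear_combination l5
  have hlim : Tendsto (fun T : ℝ => ∫ x in Set.Iic c, F (x + T * Complex.I)) atTop (𝓝 0) := by
    have hz : Tendsto (fun T : ℝ => C * T ^ (-b) * ∫ x in Set.Iic c, Real.exp (y * x)) atTop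
        (𝓝 0) := by
      simpa using ((tendsto_rpow_neg_atTop hb).const_mul C).mul_const
        (∫ x in Set.Iic c, Real.exp (y * x))
    refine squeeze_zero_norm' ?_ hz
    filter_upwards [eventually_ge_atTop 1] with T hT
    rw [← integral_const_mul]
    exact norm_integral_le_of_norm_le ((integrableOn_exp_mul_Iic hy c).const_mul _)
      (Eventually.of_forall fun x => hFn x T hT)
  have := (tendsto_const_nhds (x := hankel c A y)).add hlim
  rw [add_zero] at this
  refine this.congr' ?_
  filter_upwards [eventually_ge_atTop 1] with T hT
  exact (key T hT).symm

/-! ### The function `f₂`: derivative, limits and monotonicity. -/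

theorem one_sub_exp_neg_pos {y : ℝ} (hy : 0 < y) : 0 < 1 - Real.exp (-y) := by
  have : Real.exp (-y) < 1 := Real.exp_lt_one_iff.2 (by linarith)
  linarith

theorem hasDerivAt_log_one_sub_exp_neg {y : ℝ} (hy : 0 < y) :
    HasDerivAt (fun y => Real.log (1 - Real.exp (-y))) (1 / (Real.exp y - 1)) y := by
  have h1 : HasDerivAt (fun y : ℝ => 1 - Real.exp (-y)) (Real.exp (-y)) y := by
    simpa using ((hasDerivAt_neg y).exp).const_sub 1
  refine (h1.log (one_sub_exp_neg_pos hy).ne').congr_deriv ?_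
  have h2 : 0 < Real.exp y - 1 := by
    have := Real.one_lt_exp_iff.2 hy
    linarith
  have h3 : Real.exp (-y) * Real.exp y = 1 := by rw [← Real.exp_add]; simp
  rw [div_eq_div_iff (one_sub_exp_neg_pos hy).ne' h2.ne']
  linear_combination h3

theorem tendsto_log_one_sub_exp_neg_atTop :
    Tendsto (fun y => Real.log (1 - Real.exp (-y))) atTop (𝓝 0) := by
  have h1 : Tendsto (fun y : ℝ => 1 - Real.exp (-y)) atTop (𝓝 1) := by
    simpa using (Real.tendsto_exp_neg_atTop_nhds_zero).const_sub 1
  simpa using h1.log one_ne_zero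

/-- The dilogarithm sum `∑ e^{-ly} / l²`. -/
noncomputable def dilogSum (y : ℝ) : ℝ :=
  ∑' l : ℕ, Real.exp (-(((l : ℝ) + 1) * y)) / ((l : ℝ) + 1) ^ 2

theorem fTwo_eq (y : ℝ) :
    fTwo y = y / 2 * Real.log (1 - Real.exp (-y)) - 1 / 2 * dilogSum y := rfl

theorem norm_dilog_term_le {y : ℝ} (hy : 0 ≤ y) (l : ℕ) :
    ‖Real.exp (-(((l : ℝ) + 1) * y)) / ((l : ℝ) + 1) ^ 2‖ ≤ 1 / ((l : ℝ) + 1) ^ 2 := by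
  rw [Real.norm_of_nonneg (by positivity)]
  gcongr
  exact Real.exp_le_one_iff.2 (by simp; positivity)

theorem continuousOn_dilogSum : ContinuousOn dilogSum (Set.Ici 0) :=
  continuousOn_tsum (fun l => by fun_prop) summable_one_div_succ_sq
    fun l y hy => norm_dilog_term_le hy l

theorem dilogSum_zero : dilogSum 0 = Real.pi ^ 2 / 6 := by
  have h := (hasSum_nat_add_iff' 1).2 hasSum_zeta_two
  simp only [Finset.sum_range_one, Nat.cast_zero, ne_eq, OfNat.ofNat_ne_zero, not_false_eq_true,
    zero_pow, div_zero, sub_zero] at h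
  unfold dilogSum
  simpa using h.tsum_eq

theorem hasDerivAt_dilogSum {y : ℝ} (hy : 0 < y) :
    HasDerivAt dilogSum (Real.log (1 - Real.exp (-y))) y := by
  have hq : Real.exp (-(y / 2)) < 1 := Real.exp_lt_one_iff.2 (by linarith)
  -- Staying above `y/2` gives the differentiated series a geometric majorant; the differentiated
  -- series is that of `log(1 - e^{-y})`.
  have h := hasDerivAt_tsum_of_isPreconnected (t := Set.Ioi (y / 2)) (y₀ := y) (y := y)
    (g := fun (l : ℕ) (y : ℝ) => Real.exp (-(((l : ℝ) + 1) * y)) / ((l : ℝ) + 1) ^ 2)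
    (g' := fun (l : ℕ) (y : ℝ) => -(Real.exp (-y) ^ (l + 1) / ((l : ℝ) + 1)))
    (u := fun l : ℕ => Real.exp (-(y / 2)) ^ l)
    (summable_geometric_of_lt_one (Real.exp_pos _).le hq) isOpen_Ioi
    (convex_Ioi _).isPreconnected ?_ ?_ (show y / 2 < y by linarith)
    (Summable.of_norm_bounded summable_one_div_succ_sq fun l => norm_dilog_term_le hy.le l)
    (show y / 2 < y by linarith)
  · refine HasDerivAt.congr_deriv h ?_
    have h1 : |Real.exp (-y)| < 1 := by
      rw [abs_of_pos (Real.exp_pos _)]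
      exact Real.exp_lt_one_iff.2 (by linarith)
    rw [tsum_neg, (Real.hasSum_pow_div_log_of_abs_lt_one h1).tsum_eq, neg_neg]
  · intro l x _
    have h2 : HasDerivAt (fun x : ℝ => -(((l : ℝ) + 1) * x)) (-((l : ℝ) + 1)) x := by
      exact (((hasDerivAt_id x).const_mul ((l : ℝ) + 1)).neg).congr_deriv (by ring)
    refine (h2.exp.div_const _).congr_deriv ?_
    rw [← Real.exp_nat_mul]
    have : (l : ℝ) + 1 ≠ 0 := by positivity
    push_cast
    rw [show -(((l : ℝ) + 1) * x) = ((l : ℝ) + 1) * -x by ring]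
    field_simp
  · intro l x hx
    have hx' : y / 2 < x := hx
    rw [norm_neg, Real.norm_of_nonneg (by positivity)]
    have h3 : Real.exp (-x) ≤ Real.exp (-(y / 2)) := Real.exp_le_exp.2 (by linarith)
    calc Real.exp (-x) ^ (l + 1) / ((l : ℝ) + 1) ≤ Real.exp (-x) ^ (l + 1) := by
          refine div_le_self (by positivity) ?_
          have : (0 : ℝ) ≤ l := l.cast_nonneg
          linarith
      _ ≤ Real.exp (-x) ^ l := pow_le_pow_of_le_one (Real.exp_pos _).le (by linarith) (by omega)
      _ ≤ _ := by gcongr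

/-- The two logarithms cancel. What is left is positive, which gives monotonicity, and is recognised
again in the derivative of `I_2`. -/
theorem hasDerivAt_fTwo {y : ℝ} (hy : 0 < y) :
    HasDerivAt fTwo (1 / 2 * (y / (Real.exp y - 1))) y := by
  have h := ((((hasDerivAt_id y).div_const 2).mul (hasDerivAt_log_one_sub_exp_neg hy))).sub
    ((hasDerivAt_dilogSum hy).const_mul (1 / 2))
  refine HasDerivAt.congr_deriv h ?_
  simp only [id]
  ring

theorem tendsto_mul_log_one_sub_exp_neg :
    Tendsto (fun y : ℝ => y * Real.log (1 - Real.exp (-y))) (𝓝[>] 0) (𝓝 0) := by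
  have h1 : Tendsto (fun y : ℝ => 1 - Real.exp (-y)) (𝓝[>] 0) (𝓝[>] 0) := by
    refine tendsto_nhdsWithin_of_tendsto_nhds_of_eventually_within _ ?_ ?_
    · have : Tendsto (fun y : ℝ => 1 - Real.exp (-y)) (𝓝 0) (𝓝 (1 - Real.exp (-0))) :=
        Continuous.tendsto (by fun_prop) 0
      simp only [neg_zero, Real.exp_zero, sub_self] at this
      exact this.mono_left nhdsWithin_le_nhds
    · filter_upwards [self_mem_nhdsWithin] with y hy
      exact one_sub_exp_neg_pos hy
  have h2 : Tendsto (fun x : ℝ => Real.log x * x ^ (1 : ℝ)) (𝓝[>] 0) (𝓝 0) :=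
    tendsto_log_mul_rpow_nhdsGT_zero one_pos
  have h3 := ((h2.comp h1).norm).const_mul (Real.exp 1)
  rw [norm_zero, mul_zero] at h3
  refine squeeze_zero_norm' ?_ h3
  filter_upwards [Ioo_mem_nhdsGT (zero_lt_one (α := ℝ))] with y hy
  simp only [Function.comp_apply, Real.rpow_one, norm_mul]
  have h4 := one_sub_exp_neg_pos hy.1
  rw [Real.norm_of_nonneg hy.1.le, Real.norm_of_nonneg h4.le]
  have h5 : y ≤ Real.exp 1 * (1 - Real.exp (-y)) := by
    have h6 := Real.add_one_le_exp y
    have h7 : Real.exp y ≤ Real.exp 1 := Real.exp_le_exp.2 hy.2.le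
    have h8 : Real.exp y * (1 - Real.exp (-y)) = Real.exp y - 1 := by
      rw [mul_sub, ← Real.exp_add]; simp
    calc y ≤ Real.exp y * (1 - Real.exp (-y)) := by linarith
      _ ≤ _ := by gcongr
  calc y * ‖Real.log (1 - Real.exp (-y))‖
      ≤ (Real.exp 1 * (1 - Real.exp (-y))) * ‖Real.log (1 - Real.exp (-y))‖ := by gcongr
    _ = _ := by ring

theorem fTwo_zero : fTwo 0 = -(Real.pi ^ 2 / 12) := by
  rw [fTwo_eq, dilogSum_zero]
  ring

theorem tendsto_fTwo_zero : Tendsto fTwo (𝓝[>] 0) (𝓝 (-(Real.pi ^ 2 / 12))) := by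
  have h1 : Tendsto dilogSum (𝓝[>] 0) (𝓝 (dilogSum 0)) :=
    (continuousOn_dilogSum 0 Set.self_mem_Ici).mono_left (nhdsWithin_mono _ Set.Ioi_subset_Ici_self)
  have h2 := (tendsto_mul_log_one_sub_exp_neg.const_mul (1 / 2)).sub (h1.const_mul (1 / 2))
  rw [dilogSum_zero] at h2
  convert h2 using 2
  · rw [fTwo_eq]; ring
  · ring

theorem tendsto_fTwo_atTop : Tendsto fTwo atTop (𝓝 0) := by
  have h1 : Tendsto dilogSum atTop (𝓝 0) := by
    have h : Tendsto (fun y : ℝ => Real.exp (-y) * (Real.pi ^ 2 / 6)) atTop (𝓝 0) := by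
      simpa using Real.tendsto_exp_neg_atTop_nhds_zero.mul_const (Real.pi ^ 2 / 6)
    refine squeeze_zero' (Eventually.of_forall fun y => tsum_nonneg fun l => by positivity) ?_ h
    filter_upwards [eventually_ge_atTop 0] with y hy
    rw [← dilogSum_zero]
    unfold dilogSum
    rw [← tsum_mul_left]
    refine Summable.tsum_le_tsum (fun l => ?_)
      (Summable.of_norm_bounded summable_one_div_succ_sq fun l => norm_dilog_term_le hy l)
      ((Summable.of_norm_bounded summable_one_div_succ_sq
        fun l => norm_dilog_term_le le_rfl l).mul_left _)
    rw [mul_zero, neg_zero, Real.exp_zero, mul_one_div]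
    gcongr
    have : (0 : ℝ) ≤ l := l.cast_nonneg
    nlinarith
  have h2 : Tendsto (fun y : ℝ => y * Real.log (1 - Real.exp (-y))) atTop (𝓝 0) := by
    have h : Tendsto (fun y : ℝ => y * Real.exp (-y)) atTop (𝓝 0) := by
      simpa using Real.tendsto_pow_mul_exp_neg_atTop_nhds_zero 1
    have h' := h.const_mul (1 - Real.exp (-1))⁻¹
    rw [mul_zero] at h'
    refine squeeze_zero_norm' ?_ h'
    filter_upwards [eventually_ge_atTop 1] with y hy
    have h3 := one_sub_exp_neg_pos (by linarith : (0 : ℝ) < y)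
    have h4 := one_sub_exp_neg_pos (one_pos)
    have h5 : 1 - Real.exp (-1) ≤ 1 - Real.exp (-y) := by
      have := Real.exp_le_exp.2 (neg_le_neg hy)
      linarith
    have h6 := Real.one_sub_inv_le_log_of_pos h3
    have h7 : Real.log (1 - Real.exp (-y)) ≤ 0 :=
      Real.log_nonpos h3.le (by linarith [Real.exp_pos (-y)])
    rw [norm_mul, Real.norm_of_nonneg (by linarith), Real.norm_of_nonpos h7]
    have h8 : -Real.log (1 - Real.exp (-y)) ≤ Real.exp (-y) * (1 - Real.exp (-1))⁻¹ := by
      calc -Real.log (1 - Real.exp (-y)) ≤ (1 - Real.exp (-y))⁻¹ - 1 := by linarith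
        _ = Real.exp (-y) * (1 - Real.exp (-y))⁻¹ := by field_simp; ring
        _ ≤ _ := by gcongr
    calc y * -Real.log (1 - Real.exp (-y)) ≤ y * (Real.exp (-y) * (1 - Real.exp (-1))⁻¹) := by
          gcongr
      _ = _ := by ring
  have h3 := (h2.const_mul (1 / 2)).sub (h1.const_mul (1 / 2))
  convert h3 using 2
  · rw [fTwo_eq]; ring
  · ring

theorem monotoneOn_fTwo : MonotoneOn fTwo (Set.Ici 0) := by
  refine monotoneOn_of_deriv_nonneg (convex_Ici 0) ?_ ?_ ?_
  · intro y hy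
    rcases (show (0 : ℝ) ≤ y from hy).eq_or_lt with rfl | h
    · rw [← Set.Ioi_insert, continuousWithinAt_insert_self]
      unfold ContinuousWithinAt
      rw [fTwo_zero]
      exact tendsto_fTwo_zero
    · exact (hasDerivAt_fTwo h).continuousAt.continuousWithinAt
  · rw [interior_Ici]
    exact fun y hy => (hasDerivAt_fTwo hy).differentiableAt.differentiableWithinAt
  · rw [interior_Ici]
    intro y hy
    have hy' : (0 : ℝ) < y := hy
    rw [(hasDerivAt_fTwo hy').deriv]
    have := Real.one_lt_exp_iff.2 hy'
    have : 0 ≤ Real.exp y - 1 := by linarith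
    positivity

/-! ### Contour integrals of `1`, `1/z` and `1/z²`. -/

theorem eq_of_hasDerivAt_of_tendsto_atTop {f g f' : ℝ → ℝ} {l : ℝ}
    (hf : ∀ y, 0 < y → HasDerivAt f (f' y) y) (hg : ∀ y, 0 < y → HasDerivAt g (f' y) y)
    (hfl : Tendsto f atTop (𝓝 l)) (hgl : Tendsto g atTop (𝓝 l)) {y : ℝ} (hy : 0 < y) :
    f y = g y := by
  have hconst : ∀ x, 0 < x → (f - g) x = (f - g) y := fun x hx =>
    isOpen_Ioi.is_const_of_deriv_eq_zero (convex_Ioi (0 : ℝ)).isPreconnected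
      (fun z hz => ((hf z hz).sub (hg z hz)).differentiableAt.differentiableWithinAt)
      (fun z hz => by simp [((hf z hz).sub (hg z hz)).deriv]) hx hy
  have h1 : Tendsto (f - g) atTop (𝓝 0) := by
    rw [← sub_self l]
    exact hfl.sub hgl
  have h2 : Tendsto (f - g) atTop (𝓝 ((f - g) y)) := by
    refine tendsto_const_nhds.congr' ?_
    filter_upwards [eventually_gt_atTop 0] with x hx
    exact (hconst x hx).symm
  exact sub_eq_zero.1 (tendsto_nhds_unique h2 h1)

theorem hankel_im_add {c : ℝ} {A B : ℂ → ℂ} (hA : PolyGrowth fun t => A (hankelPath c t))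
    (hB : PolyGrowth fun t => B (hankelPath c t)) {y : ℝ} (hy : 0 < y) (r : ℝ) :
    (hankel c (fun z => A z + r * B z) y).im = (hankel c A y).im + r * (hankel c B y).im := by
  rw [hankel_add (B := fun z => (r : ℂ) * B z) hA ((polyGrowth_const _).mul hB) hy,
    hankel_const_mul, Complex.add_im, Complex.im_ofReal_mul]

theorem hasDerivAt_hankel_im {c : ℝ} {A A' : ℂ → ℂ}
    (hA : PolyGrowth fun t => A (hankelPath c t))
    (hA' : ∀ t, 0 < t → hankelPath c t * A (hankelPath c t) = A' (hankelPath c t))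
    {y : ℝ} (hy : 0 < y) :
    HasDerivAt (fun y => (hankel c A y).im) (hankel c A' y).im y := by
  have h := hasDerivAt_hankel hA hy
  rw [hankel_congr (A := fun z => z * A z) (B := A') hA'] at h
  exact (Complex.imCLM.hasFDerivAt.comp_hasDerivAt y h)

/-- `e^{zy}` has the primitive `e^{zy}/y`, so the integral is a boundary value at the real point
`c`. -/
theorem hankel_one_im (c : ℝ) {y : ℝ} (hy : 0 < y) : (hankel c (fun _ => 1) y).im = 0 := by
  have h := hankel_deriv (c := c) (B := fun _ => 1) (B' := fun _ => 0) (polyGrowth_const 1)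
    (polyGrowth_const 0) (fun t _ => hasDerivAt_const _ _) hy
  rw [show (fun _ : ℂ => (y : ℂ) * 1 + 0) = fun z => (y : ℂ) * (fun _ => 1) z by ext; simp,
    hankel_const_mul] at h
  have h2 := congrArg Complex.im h
  rw [Complex.im_ofReal_mul, show -(Complex.exp (c * y) * 1) = ((-Real.exp (c * y) : ℝ) : ℂ) by
    push_cast; ring, Complex.ofReal_im] at h2
  exact (mul_eq_zero.1 h2).resolve_left hy.ne'

theorem hankel_inv_one_eq {y : ℝ} (hy : 0 < y) :
    (hankel 1 (fun z => z⁻¹) y).im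
      = (∫ t in (0 : ℝ)..1, Complex.exp ((1 + t * Complex.I) * y) * (1 + t * Complex.I)⁻¹).re
      - ∫ x in Set.Iic (1 : ℝ), Real.exp (x * y) * (x * Real.sin y - Real.cos y) * (1 + x ^ 2)⁻¹ := by
  obtain ⟨h1, h2⟩ := hankel_eq (polyGrowth_inv_hankelPath one_pos) hy
  rw [h2, Complex.sub_im, Complex.I_mul_im, Complex.ofReal_one]
  congr 1
  have h3 := Complex.imCLM.integral_comp_comm h1
  simp only [Complex.imCLM_apply] at h3
  rw [← h3]
  refine integral_congr_ae (Eventually.of_forall fun x => ?_)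
  have e : Complex.exp ((x + Complex.I) * y) = ((Real.exp (x * y) : ℝ) : ℂ) *
      (((Real.cos y : ℝ) : ℂ) + ((Real.sin y : ℝ) : ℂ) * Complex.I) := by
    rw [add_mul, Complex.exp_add, mul_comm Complex.I, Complex.exp_mul_I]
    push_cast
    rfl
  have hn : Complex.normSq ((x : ℂ) + Complex.I) = 1 + x ^ 2 := by
    simp [Complex.normSq_apply]; ring
  simp only [e, mul_assoc, Complex.im_ofReal_mul, Complex.inv_def, hn]
  congr 1
  rw [← mul_assoc, Complex.im_mul_ofReal]
  congr 1
  simp [-Complex.ofReal_cos, -Complex.ofReal_sin]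
  ring

/-- At `y = 0` the imaginary part is the change of `arg z` along the contour: `π/4` on the segment
and `3π/4` on the ray. The ray needs dominated convergence, as the modulus of the integrand is not
integrable at `y = 0`, while its imaginary part is. -/
theorem tendsto_hankel_inv_one :
    Tendsto (fun y => (hankel 1 (fun z => z⁻¹) y).im) (𝓝[>] 0) (𝓝 Real.pi) := by
  have hv : Tendsto (fun y : ℝ => (∫ t in (0 : ℝ)..1, Complex.exp ((1 + t * Complex.I) * y)
      * (1 + t * Complex.I)⁻¹).re) (𝓝[>] 0) (𝓝 (Real.pi / 4)) := by
    have hne : ∀ t : ℝ, (1 : ℂ) + t * Complex.I ≠ 0 := fun t h => by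
      have := congrArg Complex.re h
      simp at this
    have hc : Continuous fun y : ℝ => ∫ t in (0 : ℝ)..1, Complex.exp ((1 + t * Complex.I) * y)
        * (1 + t * Complex.I)⁻¹ := by
      refine intervalIntegral.continuous_parametric_intervalIntegral_of_continuous' ?_ 0 1
      refine Continuous.mul (by fun_prop) (Continuous.inv₀ (by fun_prop) fun p => hne p.2)
    have h0 : (∫ t in (0 : ℝ)..1, Complex.exp ((1 + t * Complex.I) * (0 : ℝ))
        * (1 + t * Complex.I)⁻¹).re = Real.pi / 4 := by
      have h1 : IntervalIntegrable (fun t : ℝ => Complex.exp ((1 + t * Complex.I) * (0 : ℝ))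
        * (1 + t * Complex.I)⁻¹) volume 0 1 :=
        Continuous.intervalIntegrable
          (Continuous.mul (by fun_prop) (Continuous.inv₀ (by fun_prop) hne)) _ _
      have h2 := Complex.reCLM.intervalIntegral_comp_comm h1
      simp only [Complex.reCLM_apply] at h2
      rw [← h2]
      have h3 : ∀ t : ℝ, (Complex.exp ((1 + t * Complex.I) * (0 : ℝ)) * (1 + t * Complex.I)⁻¹).re
          = (1 + t ^ 2)⁻¹ := by
        intro t
        simp [Complex.inv_re, Complex.normSq_apply, sq]
      simp only [h3, integral_inv_one_add_sq, Real.arctan_one, Real.arctan_zero, sub_zero]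
    have := (Complex.continuous_re.comp hc).tendsto 0
    simp only [Function.comp_apply, h0] at this
    exact this.mono_left nhdsWithin_le_nhds
  have hh : Tendsto (fun y : ℝ => ∫ x in Set.Iic (1 : ℝ), Real.exp (x * y)
      * (x * Real.sin y - Real.cos y) * (1 + x ^ 2)⁻¹) (𝓝[>] 0) (𝓝 (-(3 * Real.pi / 4))) := by
    have hint : IntegrableOn (fun x : ℝ => (1 + x ^ 2)⁻¹) (Set.Iic 1) :=
      integrable_inv_one_add_sq.integrableOn
    have hval : ∫ x in Set.Iic (1 : ℝ), -(1 + x ^ 2)⁻¹ = -(3 * Real.pi / 4) := by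
      rw [integral_neg, integral_Iic_inv_one_add_sq, Real.arctan_one]
      ring
    rw [← hval]
    refine tendsto_integral_filter_of_dominated_convergence
      (fun x => 6 * (1 + x ^ 2)⁻¹) ?_ ?_ (hint.const_mul 6) ?_
    · refine Eventually.of_forall fun y => Continuous.aestronglyMeasurable ?_
      exact Continuous.mul (by fun_prop) (Continuous.inv₀ (by fun_prop) fun x => by positivity)
    · filter_upwards [Ioo_mem_nhdsGT (zero_lt_one (α := ℝ))] with y hy
      refine (ae_restrict_iff' measurableSet_Iic).2 (Eventually.of_forall fun x hx => ?_)
      have hx' : x ≤ 1 := hx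
      rw [norm_mul, Real.norm_of_nonneg (by positivity : (0 : ℝ) ≤ (1 + x ^ 2)⁻¹)]
      refine mul_le_mul_of_nonneg_right ?_ (by positivity)
      rw [norm_mul, Real.norm_of_nonneg (Real.exp_pos _).le]
      have h1 : ‖x * Real.sin y - Real.cos y‖ ≤ |x| * y + 1 := by
        refine (norm_sub_le _ _).trans (add_le_add ?_ (Real.abs_cos_le_one y))
        rw [norm_mul, Real.norm_eq_abs]
        refine mul_le_mul_of_nonneg_left ?_ (abs_nonneg x)
        refine (Real.abs_sin_le_abs).trans (le_of_eq (abs_of_pos hy.1))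
      have h2 : Real.exp (x * y) ≤ 3 := by
        refine le_trans (Real.exp_le_exp.2 (?_ : x * y ≤ 1)) (by
          linarith [Real.exp_one_lt_d9])
        nlinarith [hy.1, hy.2]
      -- The unbounded factor `x` comes with `|sin y| ≤ y`, and `u e^{-u}` is bounded for `u = -xy ≥
      -- 0`.
      have h3 : Real.exp (x * y) * (|x| * y) ≤ 3 := by
        rcases le_total 0 x with h | h
        · rw [abs_of_nonneg h]
          have : x * y ≤ 1 := by nlinarith [hy.1, hy.2]
          have h0 : 0 ≤ x * y := mul_nonneg h hy.1.le
          nlinarith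
        · rw [abs_of_nonpos h]
          have h4 := Real.add_one_le_exp (-(x * y))
          have h5 : Real.exp (x * y) * Real.exp (-(x * y)) = 1 := by
            rw [← Real.exp_add]; simp
          nlinarith [Real.exp_pos (x * y)]
      calc _ ≤ Real.exp (x * y) * (|x| * y + 1) := by gcongr
        _ ≤ 6 := by linarith
    · refine Eventually.of_forall fun x => ?_
      have hc : Continuous fun y : ℝ => Real.exp (x * y) * (x * Real.sin y - Real.cos y)
          * (1 + x ^ 2)⁻¹ := by fun_prop
      have := hc.tendsto 0
      simp only [mul_zero, Real.exp_zero, Real.sin_zero, Real.cos_zero, zero_sub, one_mul,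
        neg_mul] at this
      exact this.mono_left nhdsWithin_le_nhds
  have h := hv.sub hh
  rw [show Real.pi / 4 - -(3 * Real.pi / 4) = Real.pi by ring] at h
  refine h.congr' ?_
  filter_upwards [self_mem_nhdsWithin] with y hy
  exact (hankel_inv_one_eq hy).symm

/-- Half of the residue `2πi` at `0`. For `c = 1` the `y`-derivative is the integral of `e^{zy}`,
with imaginary part `0`, so the limit at `0` gives the value; other `c > 0` follow by shifting the
contour. -/
theorem hankel_inv_im {c : ℝ} (hc : 0 < c) {y : ℝ} (hy : 0 < y) :
    (hankel c (fun z => z⁻¹) y).im = Real.pi := by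
  have hder : ∀ y, 0 < y → HasDerivAt (fun y => (hankel 1 (fun z => z⁻¹) y).im) 0 y := by
    intro y hy
    have := hasDerivAt_hankel_im (c := 1) (A := fun z => z⁻¹) (A' := fun _ => 1)
      (polyGrowth_inv_hankelPath one_pos)
      (fun t _ => mul_inv_cancel₀ (hankelPath_ne_zero one_pos)) hy
    rwa [hankel_one_im 1 hy] at this
  have hconst : ∀ x, 0 < x → (hankel 1 (fun z => z⁻¹) x).im = (hankel 1 (fun z => z⁻¹) y).im :=
    fun x hx => isOpen_Ioi.is_const_of_deriv_eq_zero (convex_Ioi (0 : ℝ)).isPreconnected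
      (fun z hz => (hder z hz).differentiableAt.differentiableWithinAt)
      (fun z hz => by simp [(hder z hz).deriv]) hx hy
  have h1 : (hankel 1 (fun z => z⁻¹) y).im = Real.pi := by
    refine tendsto_nhds_unique (tendsto_const_nhds.congr' ?_) tendsto_hankel_inv_one
    filter_upwards [self_mem_nhdsWithin] with x hx
    exact (hconst x hx).symm
  have key : ∀ a b : ℝ, 0 < a → a ≤ b →
      (hankel a (fun z => z⁻¹) y).im = (hankel b (fun z => z⁻¹) y).im := by
    intro a b ha hab
    refine hankel_im_eq_of_le hab (polyGrowth_inv_hankelPath ha)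
      (polyGrowth_inv_hankelPath (ha.trans_le hab)) (fun z hz _ => ?_) (fun x _ => ?_) hy
    · refine differentiableAt_inv ?_
      rintro rfl
      simp at hz
      linarith
    · rw [← Complex.ofReal_inv, Complex.ofReal_im]
  rcases le_total c 1 with h | h
  · rw [key c 1 hc h, h1]
  · rw [← key 1 c one_pos h, h1]

/-- Integration by parts against `1/z`; the boundary term is real. -/
theorem hankel_inv_sq_im {c : ℝ} (hc : 0 < c) {y : ℝ} (hy : 0 < y) :
    (hankel c (fun z => (z ^ 2)⁻¹) y).im = Real.pi * y := by
  have hi := polyGrowth_inv_hankelPath hc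
  have hi2 : PolyGrowth fun t => (hankelPath c t ^ 2)⁻¹ := by
    simpa only [inv_pow] using hi.pow 2
  have h := hankel_deriv (c := c) (B := fun z => z⁻¹) (B' := fun z => -(z ^ 2)⁻¹) hi
    (by simpa using (polyGrowth_const (-1)).mul hi2)
    (fun t _ => hasDerivAt_inv (hankelPath_ne_zero hc)) hy
  have h2 := hankel_im_add (A := fun z => (y : ℂ) * z⁻¹) (B := fun z => (z ^ 2)⁻¹)
    ((polyGrowth_const _).mul hi) hi2 hy (-1)
  have h3 : (hankel c (fun z => (y : ℂ) * z⁻¹ + ((-1 : ℝ) : ℂ) * (z ^ 2)⁻¹) y).im = 0 := by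
    rw [hankel_congr (B := fun z => (y : ℂ) * z⁻¹ + -(z ^ 2)⁻¹) (fun t _ => by simp), h,
      show -(Complex.exp (c * y) * (c : ℂ)⁻¹) = ((-(Real.exp (c * y) * c⁻¹) : ℝ) : ℂ) by
        push_cast; rfl, Complex.ofReal_im]
  rw [h3, hankel_const_mul c (fun z => z⁻¹), Complex.im_ofReal_mul, hankel_inv_im hc hy] at h2
  linarith

/-! ### Contour integrals of powers of `H`. -/

theorem hankel_add_one (c : ℝ) (A : ℂ → ℂ) (y : ℝ) :
    hankel (c + 1) A y = Real.exp y * hankel c (fun z => A (z + 1)) y := by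
  unfold hankel
  rw [← integral_const_mul]
  refine setIntegral_congr_fun measurableSet_Ioi fun t _ => ?_
  have e : hankelPath (c + 1) t = hankelPath c t + 1 := by
    apply Complex.ext <;> simp [hankelPath]
    ring
  simp only [e, add_mul, Complex.exp_add, one_mul, Complex.ofReal_exp]
  ring

theorem harm_sub_one {z : ℂ} (hz : z ∈ Complex.slitPlane) : harm (z - 1) = harm z - z⁻¹ := by
  have h := harm_add_one (z := z - 1) (by simpa using hz)
  rw [sub_add_cancel, add_sub_cancel] at h
  rw [h]
  ring

/-- Translation by `1` turns `e^{zy}` into `e^y e^{zy}`, and moving the translated contour back to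
`c` preserves the imaginary part. On the right `H^k` appears with coefficient `1`, so the relation
determines `E_k` from lower powers. -/
theorem exp_mul_hankel_harm_pow {c : ℝ} (hc : 0 < c) (k : ℕ) {y : ℝ} (hy : 0 < y) :
    Real.exp y * (hankel c (fun z => harm z ^ k) y).im
      = (hankel c (fun z => (harm z - z⁻¹) ^ k) y).im := by
  have hslit : ∀ t, hankelPath c t ∈ Complex.slitPlane := by
    intro t
    rw [Complex.mem_slitPlane_iff]
    rcases le_total t 1 with h | h
    · left; simp [hankelPath, h, hc]
    · right; simp [hankelPath, h]
  have h1 : PolyGrowth fun t => harm (hankelPath c t) := polyGrowth_harm (by linarith)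
  have h2 : PolyGrowth fun t => harm (hankelPath c t - 1) ^ k := by
    simp only [harm_sub_one (hslit _)]
    have := (h1.add ((polyGrowth_const (-1)).mul (polyGrowth_inv_hankelPath hc))).pow k
    simpa [sub_eq_add_neg] using this
  have h3 : PolyGrowth fun t => harm (hankelPath (c + 1) t - 1) ^ k := by
    have e : ∀ t, hankelPath (c + 1) t - 1 = hankelPath c t := by
      intro t
      apply Complex.ext <;> simp [hankelPath]
      ring
    simp only [e]
    exact h1.pow k
  have h4 := hankel_im_eq_of_le (A := fun z => harm (z - 1) ^ k) (by linarith : c ≤ c + 1) h2 h3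
    (fun z hz _ => by
      refine DifferentiableAt.pow ?_ k
      refine DifferentiableAt.comp z (differentiableAt_harm ?_) (by fun_prop)
      rw [add_sub_cancel, Complex.mem_slitPlane_iff]
      left; linarith)
    (fun x _ => by
      have h := harm_ofReal_im (x - 1)
      rw [← Complex.ofReal_one, ← Complex.ofReal_sub,
        show harm ((x - 1 : ℝ) : ℂ) = (((harm ((x - 1 : ℝ) : ℂ)).re : ℝ) : ℂ) from
          Complex.ext (by simp) (by simpa using h), ← Complex.ofReal_pow, Complex.ofReal_im]) hy
  rw [hankel_add_one, Complex.im_ofReal_mul] at h4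
  simp only [add_sub_cancel_right] at h4
  rw [← h4]
  congr 1
  exact hankel_congr (fun t _ => by rw [harm_sub_one (hslit t)]) y

/-- Moving the contour to the left of `0` shows that the integrals of `e^{zy} H(z)^k / z` decay. -/
theorem tendsto_hankel_harm_pow_div (k : ℕ) :
    Tendsto (fun y => (hankel (1 / 2) (fun z => harm z ^ (k + 1) * z⁻¹) y).im) atTop (𝓝 0) := by
  -- `H^{k+1}/z` with its singularity at `0` removed, which is possible because `H(0) = 0`.
  set Q : ℂ → ℂ := fun z => dslope harm 0 z * harm z ^ k with hQ
  have hQe : ∀ z, z ≠ 0 → Q z = harm z ^ (k + 1) * z⁻¹ := by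
    intro z hz
    simp only [hQ, dslope_of_ne harm hz, slope_def_field, harm_zero, sub_zero, pow_succ]
    rw [div_eq_mul_inv]
    ring
  have hne : ∀ t : ℝ, 1 / 2 ≤ ‖hankelPath (-(1 / 2)) t‖ := by
    intro t
    have h : (hankelPath (-(1 / 2)) t).re ≤ -(1 / 2) := by
      simp only [hankelPath]
      linarith [le_max_right (t - 1) 0]
    refine le_trans ?_ (Complex.abs_re_le_norm _)
    rw [abs_of_nonpos (by linarith)]
    linarith
  have hpg : PolyGrowth fun t => Q (hankelPath (-(1 / 2)) t) := by
    have hne' : ∀ t : ℝ, hankelPath (-(1 / 2)) t ≠ 0 := fun t =>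
      norm_pos_iff.1 (lt_of_lt_of_le (by norm_num) (hne t))
    have hi : PolyGrowth fun t => (hankelPath (-(1 / 2)) t)⁻¹ :=
      ⟨(continuous_hankelPath _).continuousOn.inv₀ fun t _ => hne' t, 2, 0, fun t _ => by
        rw [norm_inv, pow_zero, mul_one]
        exact (inv_anti₀ (by norm_num) (hne t)).trans (by norm_num)⟩
    simp only [hQe _ (hne' _)]
    exact ((polyGrowth_harm le_rfl).pow (k + 1)).mul hi
  have hpg' : PolyGrowth fun t => Q (hankelPath (1 / 2) t) := by
    simp only [hQe _ (hankelPath_ne_zero (by norm_num : (0 : ℝ) < 1 / 2))]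
    exact ((polyGrowth_harm (by norm_num)).pow (k + 1)).mul
      (polyGrowth_inv_hankelPath (by norm_num))
  have hdiff : ∀ z : ℂ, -(1 / 2) ≤ z.re → DifferentiableAt ℂ Q z := by
    intro z hz
    have hU : IsOpen {w : ℂ | -1 < w.re} := isOpen_lt continuous_const Complex.continuous_re
    have hh : ∀ w : ℂ, -1 < w.re → DifferentiableAt ℂ harm w := fun w hw =>
      differentiableAt_harm (Complex.mem_slitPlane_iff.2 (Or.inl (by simp; linarith)))
    have hds : DifferentiableOn ℂ (dslope harm 0) {w : ℂ | -1 < w.re} :=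
      (Complex.differentiableOn_dslope (hU.mem_nhds (by simp))).2
        fun w hw => (hh w hw).differentiableWithinAt
    have hz' : z ∈ {w : ℂ | -1 < w.re} := by
      show -1 < z.re
      linarith
    exact (hds.differentiableAt (hU.mem_nhds hz')).mul ((hh z hz').pow k)
  have hreal : ∀ x : ℝ, (Q x).im = 0 := by
    intro x
    have hx : (starRingEnd ℂ) (harm x) = harm x := Complex.conj_eq_iff_im.2 (harm_ofReal_im x)
    rw [← Complex.conj_eq_iff_im]
    by_cases h0 : x = 0
    · subst h0
      have h := congrFun (deriv_conj_conj (f := harm)) 0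
      have e : (starRingEnd ℂ) ∘ harm ∘ (starRingEnd ℂ) = harm := by
        ext w
        simp [harm_conj]
      rw [e] at h
      simp only [Function.comp_apply, map_zero] at h
      simp only [hQ, Complex.ofReal_zero, dslope_same, map_mul, map_pow, harm_zero, ← h, map_zero]
    · rw [hQe _ (by exact_mod_cast h0), map_mul, map_pow, map_inv₀, hx, Complex.conj_ofReal]
  -- The whole contour lies in `Re z < 0`, so the integrand tends to `0` and for `y ≥ 1` is
  -- dominated by its value at `y = 1`.
  have hlim : Tendsto (fun y => hankel (-(1 / 2)) Q y) atTop (𝓝 0) := by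
    have h0 : (0 : ℂ) = ∫ t in Set.Ioi (0 : ℝ), (0 : ℂ) := by simp
    unfold hankel
    rw [h0]
    refine tendsto_integral_filter_of_dominated_convergence
      (fun t => ‖hankelDir t * (Complex.exp (hankelPath (-(1 / 2)) t * (1 : ℝ))
        * Q (hankelPath (-(1 / 2)) t))‖)
      (Eventually.of_forall fun y => aestronglyMeasurable_hankel hpg y) ?_
      (integrableOn_hankel hpg one_pos).norm ?_
    · filter_upwards [eventually_ge_atTop 1] with y hy
      refine Eventually.of_forall fun t => ?_
      have h : (hankelPath (-(1 / 2)) t).re ≤ 0 := by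
        simp only [hankelPath]
        linarith [le_max_right (t - 1) 0]
      simp only [norm_mul, Complex.norm_exp, Complex.re_mul_ofReal]
      gcongr ?_ * (Real.exp ?_ * ?_)
      nlinarith
    · refine Eventually.of_forall fun t => ?_
      have h : (hankelPath (-(1 / 2)) t).re < 0 := by
        simp only [hankelPath]
        linarith [le_max_right (t - 1) 0]
      have h1 : Tendsto (fun y : ℝ => Complex.exp (hankelPath (-(1 / 2)) t * y)) atTop (𝓝 0) := by
        rw [tendsto_zero_iff_norm_tendsto_zero]
        simp only [Complex.norm_exp, Complex.re_mul_ofReal]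
        exact Real.tendsto_exp_atBot.comp (tendsto_id.const_mul_atTop_of_neg h)
      simpa using (h1.mul_const (Q (hankelPath (-(1 / 2)) t))).const_mul (hankelDir t)
  have him := (Complex.continuous_im.tendsto 0).comp hlim
  rw [Complex.zero_im] at him
  refine him.congr' ?_
  filter_upwards [eventually_gt_atTop 0] with y hy
  rw [Function.comp_apply, hankel_im_eq_of_le (c' := 1 / 2) (by norm_num) hpg hpg'
    (fun z hz _ => hdiff z hz) (fun x _ => hreal x) hy]
  congr 1
  exact hankel_congr (fun t _ => hQe _ (hankelPath_ne_zero (by norm_num))) y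

theorem hasDerivAt_hankel_harm_pow_div (k : ℕ) {y : ℝ} (hy : 0 < y) :
    HasDerivAt (fun y => (hankel (1 / 2) (fun z => harm z ^ k * z⁻¹) y).im)
      (hankel (1 / 2) (fun z => harm z ^ k) y).im y := by
  refine hasDerivAt_hankel_im (((polyGrowth_harm (by norm_num)).pow k).mul
    (polyGrowth_inv_hankelPath (by norm_num))) (fun t _ => ?_) hy
  rw [mul_left_comm, mul_inv_cancel₀ (hankelPath_ne_zero (by norm_num)), mul_one]

theorem exp_sub_one_ne_zero {y : ℝ} (hy : 0 < y) : Real.exp y - 1 ≠ 0 := by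
  have := Real.one_lt_exp_iff.2 hy
  linarith

/-- The shift relation for `k = 1` reads `(e^y - 1) E_1 = -π`; integrate from infinity. -/
theorem hankel_harm_div_im {y : ℝ} (hy : 0 < y) :
    (hankel (1 / 2) (fun z => harm z ^ 1 * z⁻¹) y).im
      = -Real.pi * Real.log (1 - Real.exp (-y)) := by
  have hc : (0 : ℝ) < 1 / 2 := by norm_num
  have hE : ∀ y, 0 < y → (hankel (1 / 2) (fun z => harm z ^ 1) y).im
      = -Real.pi * (1 / (Real.exp y - 1)) := by
    intro y hy
    have h := exp_mul_hankel_harm_pow hc 1 hy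
    have h2 := hankel_im_add (c := 1 / 2) (A := fun z => harm z ^ 1) (B := fun z => z⁻¹)
      ((polyGrowth_harm (by norm_num)).pow 1) (polyGrowth_inv_hankelPath hc) hy (-1)
    rw [hankel_congr (A := fun z => (harm z - z⁻¹) ^ 1)
      (B := fun z => harm z ^ 1 + ((-1 : ℝ) : ℂ) * z⁻¹)
      (fun t _ => by push_cast; ring), h2, hankel_inv_im hc hy] at h
    rw [mul_one_div, eq_div_iff (exp_sub_one_ne_zero hy)]
    linarith
  refine eq_of_hasDerivAt_of_tendsto_atTop (fun y hy => hasDerivAt_hankel_harm_pow_div 1 hy)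
    (fun y hy => ?_) (tendsto_hankel_harm_pow_div 0)
    (g := fun y => -Real.pi * Real.log (1 - Real.exp (-y))) ?_ hy
  · rw [hE y hy]
    exact (hasDerivAt_log_one_sub_exp_neg hy).const_mul _
  · simpa using tendsto_log_one_sub_exp_neg_atTop.const_mul (-Real.pi)

/-- The shift relation for `k = 2` reads `(e^y - 1) E_2 = -2 I_1 + πy = π(2L + y)`. The part with
`L` integrates to `πL²`; the part `πy/(e^y - 1)` is `2π f₂'`. -/
theorem hankel_harm_sq_div_im {y : ℝ} (hy : 0 < y) :
    (hankel (1 / 2) (fun z => harm z ^ 2 * z⁻¹) y).im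
      = Real.pi * (Real.log (1 - Real.exp (-y)) ^ 2 + 2 * fTwo y) := by
  have hc : (0 : ℝ) < 1 / 2 := by norm_num
  have hE : ∀ y, 0 < y → (hankel (1 / 2) (fun z => harm z ^ 2) y).im
      = Real.pi * (2 * Real.log (1 - Real.exp (-y)) * (1 / (Real.exp y - 1))
        + 2 * (1 / 2 * (y / (Real.exp y - 1)))) := by
    intro y hy
    have h := exp_mul_hankel_harm_pow hc 2 hy
    have hh : PolyGrowth fun t => harm (hankelPath (1 / 2) t) := polyGrowth_harm (by norm_num)
    have hi := polyGrowth_inv_hankelPath hc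
    have hi2 : PolyGrowth fun t => (hankelPath (1 / 2) t ^ 2)⁻¹ := by
      simpa only [inv_pow] using hi.pow 2
    have hhi := (hh.pow 1).mul hi
    have h2 := hankel_im_add (c := 1 / 2) (A := fun z => harm z ^ 2)
      (B := fun z => harm z ^ 1 * z⁻¹) (hh.pow 2) hhi hy (-2)
    have h3 := hankel_im_add (c := 1 / 2)
      (A := fun z => harm z ^ 2 + ((-2 : ℝ) : ℂ) * (harm z ^ 1 * z⁻¹))
      (B := fun z => (z ^ 2)⁻¹) ((hh.pow 2).add ((polyGrowth_const _).mul hhi)) hi2 hy 1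
    rw [hankel_congr (A := fun z => (harm z - z⁻¹) ^ 2)
      (B := fun z => harm z ^ 2 + ((-2 : ℝ) : ℂ) * (harm z ^ 1 * z⁻¹)
      + ((1 : ℝ) : ℂ) * (z ^ 2)⁻¹) (fun t _ => by push_cast; rw [← inv_pow]; ring), h3, h2,
      hankel_inv_sq_im hc hy, hankel_harm_div_im hy] at h
    have h4 := exp_sub_one_ne_zero hy
    have h5 : ∀ x : ℝ, Real.pi * (2 * x * (1 / (Real.exp y - 1)) + 2 * (1 / 2 * (y / (Real.exp y - 1))))
        = Real.pi * (2 * x + y) / (Real.exp y - 1) := by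
      intro x
      field_simp
    rw [h5, eq_div_iff h4]
    linarith
  refine eq_of_hasDerivAt_of_tendsto_atTop (fun y hy => hasDerivAt_hankel_harm_pow_div 2 hy)
    (fun y hy => ?_) (tendsto_hankel_harm_pow_div 1)
    (g := fun y => Real.pi * (Real.log (1 - Real.exp (-y)) ^ 2 + 2 * fTwo y)) ?_ hy
  · rw [hE y hy]
    refine ((((hasDerivAt_log_one_sub_exp_neg hy).pow 2).add
      ((hasDerivAt_fTwo hy).const_mul 2)).const_mul Real.pi).congr_deriv ?_
    simp
  · simpa using ((tendsto_log_one_sub_exp_neg_atTop.pow 2).add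
      (tendsto_fTwo_atTop.const_mul 2)).const_mul Real.pi

/-! ### The density and the distribution function as contour integrals. -/

/-- The density of the limit law on the scale `y = s / α`, with `a = 1 / α`. -/
noncomputable def hankelDensity (a y : ℝ) : ℝ :=
  (hankel (1 / 2) (fun z => Complex.exp (-(a : ℂ) * harm z)) y).im / Real.pi

/-- The distribution function of the limit law on the scale `y = s / α`, with `a = 1 / α`. -/
noncomputable def hankelCdf (a y : ℝ) : ℝ :=
  (hankel (1 / 2) (fun z => Complex.exp (-(a : ℂ) * harm z) * z⁻¹) y).im / Real.pi

theorem polyGrowth_exp_harm_mul_inv {c : ℝ} (hc : 0 < c) (a : ℂ) :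
    PolyGrowth fun t => Complex.exp (a * harm (hankelPath c t)) * (hankelPath c t)⁻¹ :=
  (polyGrowth_exp_harm (by linarith) a).mul (polyGrowth_inv_hankelPath hc)

theorem differentiableAt_exp_harm {z : ℂ} (hz : z ∈ logRegion) (a : ℂ) :
    DifferentiableAt ℂ (fun z => Complex.exp (a * harm z)) z :=
  ((differentiableAt_harm (one_add_mem_slitPlane_of_mem hz)).const_mul a).cexp

theorem exp_mul_harm_ofReal (a x : ℝ) :
    Complex.exp (-(a : ℂ) * harm x) = ((Real.exp (-a * (harm x).re) : ℝ) : ℂ) := by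
  rw [show harm (x : ℂ) = (((harm (x : ℂ)).re : ℝ) : ℂ) from
    Complex.ext (by simp) (by simp [harm_ofReal_im])]
  push_cast
  rfl

theorem norm_exp_harm_le_im {a : ℝ} (ha : 0 < a) {z : ℂ} (hz : 1 ≤ z.im) :
    ‖Complex.exp (-(a : ℂ) * harm z)‖ ≤ Real.exp (a * (9 * Real.pi + 1)) * z.im ^ (-a) := by
  refine (norm_exp_neg_mul_harm_le (Or.inr hz) ha.le).trans ?_
  have h : z.im ≤ ‖1 + z‖ := by
    have := (le_abs_self _).trans (Complex.abs_im_le_norm (1 + z))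
    simpa using this
  refine mul_le_mul_of_nonneg_left ?_ (Real.exp_pos _).le
  exact Real.rpow_le_rpow_of_nonpos (by linarith) h (by linarith)

/-- The imaginary axis is bent at `c = 0`, then the contour is moved to `1/2`, its standard start
once `1/z` is present; `e^{-aH}` has no singularity in between. -/
theorem tendsto_vertical_density {a : ℝ} (ha : 0 < a) {y : ℝ} (hy : 0 < y) :
    Tendsto (fun T : ℝ => (∫ t in (0 : ℝ)..T, Complex.exp ((t * Complex.I) * y)
      * Complex.exp (-(a : ℂ) * harm (t * Complex.I))).re) atTop
      (𝓝 (Real.pi * hankelDensity a y)) := by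
  have h := tendsto_vertical_hankel (c := 0) (A := fun z => Complex.exp (-(a : ℂ) * harm z))
    (polyGrowth_exp_harm (by norm_num) _)
    (fun z hz => differentiableAt_exp_harm (Or.inr hz) _) ha
    (fun z hz => norm_exp_harm_le_im ha hz) hy
  have h2 := hankel_im_eq_of_le (c := 0) (c' := 1 / 2) (by norm_num)
    (A := fun z => Complex.exp (-(a : ℂ) * harm z))
    (polyGrowth_exp_harm (by norm_num) _) (polyGrowth_exp_harm (by norm_num) _)
    (fun z hz _ => differentiableAt_exp_harm (Or.inl (by linarith)) _)
    (fun x _ => by rw [exp_mul_harm_ofReal, Complex.ofReal_im]) hy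
  have h3 := (Complex.continuous_im.tendsto _).comp h
  rw [h2] at h3
  have h4 : Real.pi * hankelDensity a y
      = (hankel (1 / 2) (fun z => Complex.exp (-(a : ℂ) * harm z)) y).im := by
    unfold hankelDensity
    field_simp
  rw [h4]
  refine h3.congr fun T => ?_
  simp only [Function.comp_apply, Complex.I_mul_im, Complex.ofReal_zero, zero_add]

theorem continuous_vertical_density (a y : ℝ) : Continuous fun t : ℝ =>
    Complex.exp ((t * Complex.I) * y) * Complex.exp (-(a : ℂ) * harm (t * Complex.I)) := by
  refine Continuous.mul (by fun_prop) (continuous_iff_continuousAt.2 fun t => ?_)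
  exact ContinuousAt.comp (f := fun t : ℝ => (t : ℂ) * Complex.I)
    (g := fun z => Complex.exp (-(a : ℂ) * harm z))
    (differentiableAt_exp_harm (Or.inl (by simp)) _).continuousAt (by fun_prop)

theorem gInfTrunc_eq {α : ℝ} (hα : 0 < α) (s T : ℝ) :
    gInfTrunc α s T = ((1 / (Real.pi * α) * (∫ t in (0 : ℝ)..(α * T),
      Complex.exp ((t * Complex.I) * (s / α : ℝ))
        * Complex.exp (-((1 / α : ℝ) : ℂ) * harm (t * Complex.I))).re : ℝ) : ℂ) := by
  set Φ : ℝ → ℂ := fun t => Complex.exp ((t * Complex.I) * (s / α : ℝ))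
    * Complex.exp (-((1 / α : ℝ) : ℂ) * harm (t * Complex.I)) with hΦ
  have hΦc : Continuous Φ := continuous_vertical_density _ _
  have hα' : (α : ℂ) ≠ 0 := by exact_mod_cast hα.ne'
  have h1 : ∀ t : ℝ, Complex.exp (-(Complex.I * (s : ℂ) * (t : ℂ))) * charInf α t
      = Φ (-(α * t)) := by
    intro t
    rw [charInf_eq_exp_harm]
    simp only [hΦ]
    congr 2
    · push_cast
      field_simp
    · congr 2
      push_cast
      ring
  have h2 : ∀ t : ℝ, Φ (-t) = (starRingEnd ℂ) (Φ t) := by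
    intro t
    simp only [hΦ, map_mul, ← Complex.exp_conj, map_neg, Complex.conj_ofReal, Complex.conj_I,
      ← harm_conj]
    rw [show ((-t : ℝ) : ℂ) * Complex.I = t * -Complex.I by push_cast; ring]
  have h3 : ∫ t in (-T)..T, Complex.exp (-(Complex.I * (s : ℂ) * (t : ℂ))) * charInf α t
      = (α : ℂ)⁻¹ * ∫ t in (-(α * T))..(α * T), Φ t := by
    simp only [h1]
    have h := intervalIntegral.integral_comp_neg (a := -T) (b := T) (fun t => Φ (α * t))
    simp only [mul_neg, neg_neg] at h
    rw [h, intervalIntegral.integral_comp_mul_left (fun t => Φ t) hα.ne']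
    simp
  have h4 : ∫ t in (-(α * T))..(α * T), Φ t = ((2 * (∫ t in (0 : ℝ)..(α * T), Φ t).re : ℝ) : ℂ) := by
    rw [← intervalIntegral.integral_add_adjacent_intervals (hΦc.intervalIntegrable _ 0)
      (hΦc.intervalIntegrable 0 _)]
    have h5 : ∫ t in (-(α * T))..0, Φ t = (starRingEnd ℂ) (∫ t in (0 : ℝ)..(α * T), Φ t) := by
      have h6 := intervalIntegral.integral_comp_neg (a := 0) (b := α * T) Φ
      rw [neg_zero] at h6
      rw [← h6]
      simp only [h2]
      exact intervalIntegral.intervalIntegral_conj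
    rw [h5, add_comm, Complex.add_conj]
  unfold gInfTrunc
  rw [h3, h4]
  push_cast
  have : (Real.pi : ℂ) ≠ 0 := by exact_mod_cast Real.pi_ne_zero
  field_simp

theorem tendsto_gInfTrunc {α : ℝ} (hα : 0 < α) {s : ℝ} (hs : 0 < s) :
    Tendsto (fun T : ℝ => gInfTrunc α s T) atTop
      (𝓝 ((hankelDensity (1 / α) (s / α) / α : ℝ) : ℂ)) := by
  simp only [gInfTrunc_eq hα]
  refine (Complex.continuous_ofReal.tendsto _).comp ?_
  have h := ((tendsto_vertical_density (a := 1 / α) (by positivity) (y := s / α)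
    (by positivity)).comp (tendsto_id.const_mul_atTop hα)).const_mul (1 / (Real.pi * α))
  rw [show 1 / (Real.pi * α) * (Real.pi * hankelDensity (1 / α) (s / α))
    = hankelDensity (1 / α) (s / α) / α by
      have := Real.pi_ne_zero
      field_simp] at h
  exact h

theorem gInf_eq {α : ℝ} (hα : 0 < α) {s : ℝ} (hs : 0 < s) :
    gInf α s = hankelDensity (1 / α) (s / α) / α := by
  unfold gInf
  rw [(tendsto_gInfTrunc hα hs).limUnder_eq, Complex.ofReal_re]

theorem norm_one_add_hankelPath_ge (t : ℝ) :
    1 ≤ ‖1 + hankelPath (1 / 2) t‖ ∧ t / 4 ≤ ‖1 + hankelPath (1 / 2) t‖ := by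
  rcases le_total t 1 with h | h
  · have h1 : 1 ≤ ‖1 + hankelPath (1 / 2) t‖ := by
      refine le_trans ?_ (Complex.re_le_norm _)
      simp [hankelPath, h]
    exact ⟨h1, by linarith⟩
  · constructor
    · refine le_trans ?_ ((le_abs_self _).trans (Complex.abs_im_le_norm _))
      simp [hankelPath, h]
    · refine le_of_sq_le_sq ?_ (norm_nonneg _)
      rw [← Complex.normSq_eq_norm_sq, Complex.normSq_apply]
      simp only [hankelPath, Complex.add_re, Complex.add_im, Complex.one_re, Complex.one_im,
        min_eq_right h, max_eq_left (by linarith : (0 : ℝ) ≤ t - 1)]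
      nlinarith [sq_nonneg (t - 8 / 3)]

theorem exists_abs_hankelDensity_le {a : ℝ} (ha : 0 < a) :
    ∃ C r : ℝ, -1 < r ∧ ∀ y : ℝ, 0 < y → |hankelDensity a y| ≤ C * Real.exp (3 / 2 * y) * y ^ r := by
  -- The bound is the Gamma integral of `t^{-b} e^{-yt}`, which needs `b < 1`. Weakening the
  -- exponent `a` to `b` is allowed since `|1 + z| ≥ 1` on the contour.
  set b : ℝ := min a (1 / 2) with hb
  have hb0 : 0 < b := lt_min ha (by norm_num)
  have hb1 : b ≤ 1 / 2 := min_le_right _ _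
  set K : ℝ := Real.exp (a * (9 * Real.pi + 1)) with hK
  refine ⟨K * 4 ^ b * Real.Gamma (1 - b) / Real.pi, b - 1, by linarith, fun y hy => ?_⟩
  have hA : ∀ t : ℝ, 0 < t → ‖Complex.exp (-(a : ℂ) * harm (hankelPath (1 / 2) t))‖
      ≤ K * 4 ^ b * t ^ ((1 - b) - 1) := by
    intro t ht
    obtain ⟨h1, h2⟩ := norm_one_add_hankelPath_ge t
    refine (norm_exp_neg_mul_harm_le (hankelPath_mem_logRegion (by norm_num) t) ha.le).trans ?_
    rw [mul_assoc]
    refine mul_le_mul_of_nonneg_left ?_ (Real.exp_pos _).le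
    calc ‖1 + hankelPath (1 / 2) t‖ ^ (-a) ≤ ‖1 + hankelPath (1 / 2) t‖ ^ (-b) :=
          Real.rpow_le_rpow_of_exponent_le h1 (neg_le_neg (min_le_left _ _))
      _ ≤ (t / 4) ^ (-b) := Real.rpow_le_rpow_of_nonpos (by positivity) h2 (by linarith)
      _ = 4 ^ b * t ^ ((1 - b) - 1) := by
          rw [Real.div_rpow ht.le (by norm_num), Real.rpow_neg (by norm_num : (0 : ℝ) ≤ 4)]
          rw [show (1 - b) - 1 = -b by ring]
          field_simp
  have hint : IntegrableOn (fun t : ℝ => t ^ ((1 - b) - 1) * Real.exp (-(y * t))) (Set.Ioi 0) := by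
    -- A non-integrable function has integral `0` by convention, whereas the Gamma integral is
    -- positive.
    refine not_imp_comm.1 integral_undef ?_
    rw [Real.integral_rpow_mul_exp_neg_mul_Ioi (by linarith) hy]
    have := Real.Gamma_pos_of_pos (by linarith : 0 < 1 - b)
    positivity
  have hn : ‖hankel (1 / 2) (fun z => Complex.exp (-(a : ℂ) * harm z)) y‖
      ≤ ∫ t in Set.Ioi (0 : ℝ), K * 4 ^ b * Real.exp (3 / 2 * y)
        * (t ^ ((1 - b) - 1) * Real.exp (-(y * t))) := by
    refine norm_integral_le_of_norm_le (hint.const_mul _) ?_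
    refine (ae_restrict_iff' measurableSet_Ioi).2 (Eventually.of_forall fun t ht => ?_)
    have ht' : (0 : ℝ) < t := ht
    rw [norm_mul, norm_hankelDir, one_mul, norm_mul]
    have h3 := norm_exp_hankelPath_mul_le (1 / 2) t hy.le
    calc _ ≤ (Real.exp (y * (1 / 2 + 1)) * Real.exp (-(y * t))) * (K * 4 ^ b * t ^ ((1 - b) - 1)) :=
          mul_le_mul h3 (hA t ht') (norm_nonneg _) (by positivity)
      _ = _ := by
          rw [show y * (1 / 2 + 1) = 3 / 2 * y by ring]
          ring
  rw [integral_const_mul, Real.integral_rpow_mul_exp_neg_mul_Ioi (by linarith) hy] at hn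
  unfold hankelDensity
  rw [abs_div, abs_of_pos Real.pi_pos, div_le_iff₀ Real.pi_pos]
  refine ((Complex.abs_im_le_norm _).trans hn).trans (le_of_eq ?_)
  rw [one_div, Real.inv_rpow hy.le, ← Real.rpow_neg hy.le, neg_sub]
  have := Real.pi_ne_zero
  field_simp

theorem hasDerivAt_hankelCdf (a : ℝ) {y : ℝ} (hy : 0 < y) :
    HasDerivAt (hankelCdf a) (hankelDensity a y) y := by
  refine (hasDerivAt_hankel_im (polyGrowth_exp_harm_mul_inv (by norm_num) _)
    (fun t _ => ?_) hy).div_const Real.pi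
  rw [mul_left_comm, mul_inv_cancel₀ (hankelPath_ne_zero (by norm_num)), mul_one]

theorem continuousOn_hankelDensity (a : ℝ) : ContinuousOn (hankelDensity a) (Set.Ioi 0) := by
  intro y hy
  refine ContinuousAt.continuousWithinAt (ContinuousAt.div_const ?_ _)
  exact Complex.continuous_im.continuousAt.comp
    (hasDerivAt_hankel (polyGrowth_exp_harm (by norm_num) _) hy).continuousAt

theorem intervalIntegrable_hankelDensity {a : ℝ} (ha : 0 < a) {y : ℝ} (hy : 0 ≤ y) :
    IntervalIntegrable (hankelDensity a) volume 0 y := by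
  obtain ⟨C, r, hr, h⟩ := exists_abs_hankelDensity_le ha
  have hC : 0 ≤ C := by
    have h1 := (abs_nonneg _).trans (h 1 one_pos)
    rw [Real.one_rpow, mul_one] at h1
    exact nonneg_of_mul_nonneg_left h1 (Real.exp_pos _)
  rw [intervalIntegrable_iff_integrableOn_Ioc_of_le hy]
  have h1 : IntegrableOn (fun x : ℝ => C * Real.exp (3 / 2 * y) * x ^ r) (Set.Ioc 0 y) := by
    rw [← intervalIntegrable_iff_integrableOn_Ioc_of_le hy]
    exact (intervalIntegral.intervalIntegrable_rpow' hr).const_mul _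
  refine Integrable.mono' h1 (((continuousOn_hankelDensity a).mono
    Set.Ioc_subset_Ioi_self).aestronglyMeasurable measurableSet_Ioc) ?_
  refine (ae_restrict_iff' measurableSet_Ioc).2 (Eventually.of_forall fun x hx => ?_)
  refine (h x hx.1).trans ?_
  have := hx.1
  have := hx.2
  gcongr

theorem add_le_two_mul_norm {c t : ℝ} : c + t ≤ 2 * ‖(c : ℂ) + t * Complex.I‖ := by
  have h1 := Complex.re_le_norm ((c : ℂ) + t * Complex.I)
  have h2 := (le_abs_self _).trans (Complex.abs_im_le_norm ((c : ℂ) + t * Complex.I))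
  simp at h1 h2
  linarith

/-- Estimated on the vertical ray, where the factor `1/z` makes the integrand `O((c + t)^{-1-a})`.
The dependence on `c` is explicit so that `c = 1/y` can be chosen. -/
theorem norm_hankel_cdf_le {a c y : ℝ} (ha : 0 < a) (hc : 0 < c) (hy : 0 < y) :
    ‖hankel c (fun z => Complex.exp (-(a : ℂ) * harm z) * z⁻¹) y‖
      ≤ Real.exp (c * y) * Real.exp (a * (9 * Real.pi + 1)) * 2 ^ (1 + a) / a * c ^ (-a) := by
  set K : ℝ := Real.exp (a * (9 * Real.pi + 1)) with hK
  have hlim := (tendsto_vertical_hankel (c := c)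
    (A := fun z => Complex.exp (-(a : ℂ) * harm z) * z⁻¹)
    (polyGrowth_exp_harm_mul_inv hc _)
    (fun z hz => (differentiableAt_exp_harm (Or.inr hz) _).mul (differentiableAt_inv (by
      rintro rfl
      simp at hz
      linarith))) ha (C := K)
    (fun z hz => by
      rw [norm_mul, norm_inv]
      have h1 : 1 ≤ ‖z‖ := hz.trans ((le_abs_self _).trans (Complex.abs_im_le_norm z))
      exact (mul_le_of_le_one_right (norm_nonneg _) (inv_le_one_of_one_le₀ h1)).trans
        (norm_exp_harm_le_im ha hz)) hy).norm
  refine le_of_tendsto hlim ?_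
  filter_upwards [eventually_ge_atTop 0] with T hT
  rw [norm_mul, Complex.norm_I, one_mul]
  have hint : IntervalIntegrable (fun t : ℝ => Real.exp (c * y) * K * 2 ^ (1 + a)
      * (c + t) ^ (-(1 + a))) volume 0 T := by
    refine ContinuousOn.intervalIntegrable (continuousOn_const.mul ?_)
    rw [Set.uIcc_of_le hT]
    refine ContinuousOn.rpow_const (by fun_prop) fun t ht => Or.inl ?_
    have := ht.1
    positivity
  refine (intervalIntegral.norm_integral_le_of_norm_le hT (Eventually.of_forall fun t ht => ?_)
    hint).trans ?_
  · have ht0 : 0 < t := ht.1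
    have hmem : (c : ℂ) + t * Complex.I ∈ logRegion := Or.inl (by simp; linarith)
    have h1 := norm_exp_neg_mul_harm_le hmem ha.le
    have h2 := add_le_two_mul_norm (c := c) (t := t)
    set w : ℂ := (c : ℂ) + t * Complex.I with hw
    have h3 : ‖w‖ ≤ ‖1 + w‖ := by
      refine le_of_sq_le_sq ?_ (norm_nonneg _)
      rw [← Complex.normSq_eq_norm_sq, ← Complex.normSq_eq_norm_sq, Complex.normSq_apply,
        Complex.normSq_apply]
      simp [hw]
      nlinarith
    have hw0 : 0 < ‖w‖ := by linarith
    have h4 : ‖Complex.exp (w * y)‖ = Real.exp (c * y) := by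
      rw [Complex.norm_exp, Complex.re_mul_ofReal]
      simp [hw]
    rw [norm_mul, norm_mul, norm_inv, h4]
    have h5 : ‖1 + w‖ ^ (-a) ≤ ‖w‖ ^ (-a) := Real.rpow_le_rpow_of_nonpos hw0 h3 (by linarith)
    have h6 : ‖w‖ ^ (-a) * ‖w‖⁻¹ = ‖w‖ ^ (-(1 + a)) := by
      rw [← Real.rpow_neg_one ‖w‖, ← Real.rpow_add hw0]
      congr 1
      ring
    have h7 : ‖w‖ ^ (-(1 + a)) ≤ ((c + t) / 2) ^ (-(1 + a)) :=
      Real.rpow_le_rpow_of_nonpos (by positivity) (by linarith) (by linarith)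
    have h8 : ((c + t) / 2) ^ (-(1 + a)) = 2 ^ (1 + a) * (c + t) ^ (-(1 + a)) := by
      rw [Real.div_rpow (by positivity) (by norm_num), Real.rpow_neg (by norm_num : (0 : ℝ) ≤ 2)]
      field_simp
    calc Real.exp (c * y) * (‖Complex.exp (-(a : ℂ) * harm w)‖ * ‖w‖⁻¹)
        ≤ Real.exp (c * y) * ((K * ‖w‖ ^ (-a)) * ‖w‖⁻¹) := by
          gcongr
          exact h1.trans (mul_le_mul_of_nonneg_left h5 (Real.exp_pos _).le)
      _ = Real.exp (c * y) * K * ‖w‖ ^ (-(1 + a)) := by rw [← h6]; ring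
      _ ≤ Real.exp (c * y) * K * (2 ^ (1 + a) * (c + t) ^ (-(1 + a))) := by
          rw [← h8]
          gcongr
      _ = _ := by ring
  · rw [intervalIntegral.integral_const_mul,
      intervalIntegral.integral_comp_add_left (fun u : ℝ => u ^ (-(1 + a))) c, add_zero,
      integral_rpow (Or.inr ⟨by linarith, fun h => by
        rw [Set.uIcc_of_le (by linarith)] at h
        linarith [h.1]⟩)]
    rw [show -(1 + a) + 1 = -a by ring]
    have h9 : ((c + T) ^ (-a) - c ^ (-a)) / -a ≤ c ^ (-a) / a := by
      rw [div_neg, ← neg_div, neg_sub]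
      gcongr
      have : 0 ≤ (c + T) ^ (-a) := by positivity
      linarith
    calc _ ≤ Real.exp (c * y) * K * 2 ^ (1 + a) * (c ^ (-a) / a) := by gcongr
      _ = _ := by ring

/-- With the contour starting at `1/y`, `e^{cy} = e` stays bounded and `c^{-a}` becomes `y^a`. The
restriction `y ≤ 2` only ensures `1/2 ≤ 1/y`. -/
theorem tendsto_hankelCdf_zero {a : ℝ} (ha : 0 < a) :
    Tendsto (hankelCdf a) (𝓝[>] 0) (𝓝 0) := by
  set M : ℝ := Real.exp 1 * Real.exp (a * (9 * Real.pi + 1)) * 2 ^ (1 + a) / a with hM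
  have hle : ∀ y : ℝ, 0 < y → y ≤ 2 → ‖hankelCdf a y‖ ≤ M / Real.pi * y ^ a := by
    intro y hy hy2
    have hyc : 1 / 2 ≤ 1 / y := one_div_le_one_div_of_le hy hy2
    have h := hankel_im_eq_of_le hyc (A := fun z => Complex.exp (-(a : ℂ) * harm z) * z⁻¹)
      (polyGrowth_exp_harm_mul_inv (by norm_num) _) (polyGrowth_exp_harm_mul_inv (by positivity) _)
      (fun z hz _ => (differentiableAt_exp_harm (Or.inl (by linarith)) _).mul
        (differentiableAt_inv (by
          rintro rfl
          simp at hz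
          linarith)))
      (fun x _ => by
        rw [exp_mul_harm_ofReal, ← Complex.ofReal_inv, ← Complex.ofReal_mul, Complex.ofReal_im]) hy
    have h2 := norm_hankel_cdf_le ha (c := 1 / y) (by positivity) hy
    rw [one_div_mul_cancel hy.ne', ← hM, one_div, Real.inv_rpow hy.le, Real.rpow_neg hy.le,
      inv_inv] at h2
    unfold hankelCdf
    rw [h, norm_div, Real.norm_of_nonneg Real.pi_pos.le, div_mul_eq_mul_div, one_div]
    gcongr
    exact (Complex.abs_im_le_norm _).trans h2
  have hz : Tendsto (fun y : ℝ => M / Real.pi * y ^ a) (𝓝[>] 0) (𝓝 0) := by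
    have h1 : Tendsto (fun y : ℝ => y ^ a) (𝓝 0) (𝓝 (0 ^ a)) :=
      (Real.continuousAt_rpow_const 0 a (Or.inr ha.le)).tendsto
    rw [Real.zero_rpow ha.ne'] at h1
    simpa using (h1.mono_left nhdsWithin_le_nhds).const_mul (M / Real.pi)
  refine squeeze_zero_norm' ?_ hz
  filter_upwards [Ioo_mem_nhdsGT (zero_lt_two (α := ℝ))] with y hy
  exact hle y hy.1 hy.2.le

theorem intervalIntegrable_gInf {α : ℝ} (hα : 0 < α) {σ : ℝ} (hσ : 0 ≤ σ) :
    IntervalIntegrable (gInf α) volume 0 σ := by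
  have h := intervalIntegrable_hankelDensity (a := 1 / α) (by positivity)
    (div_nonneg hσ hα.le : 0 ≤ σ / α)
  have h2 := (h.comp_mul_left (c := α⁻¹)).div_const α
  rw [zero_div, div_inv_eq_mul, div_mul_cancel₀ _ hα.ne'] at h2
  rw [intervalIntegrable_iff_integrableOn_Ioc_of_le hσ] at h2 ⊢
  refine h2.congr ?_
  refine (ae_restrict_iff' measurableSet_Ioc).2 (Eventually.of_forall fun s hs => ?_)
  simp only [gInf_eq hα hs.1]
  rw [inv_mul_eq_div]

theorem GInf_eq {α : ℝ} (hα : 0 < α) {σ : ℝ} (hσ : 0 < σ) :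
    GInf α σ = hankelCdf (1 / α) (σ / α) := by
  have ha : 0 < 1 / α := by positivity
  have hy : 0 < σ / α := by positivity
  have h1 : GInf α σ = ∫ s in (0 : ℝ)..σ, hankelDensity (1 / α) (s / α) / α := by
    unfold GInf
    refine intervalIntegral.integral_congr_ae (Eventually.of_forall fun s hs => ?_)
    rw [Set.uIoc_of_le hσ.le] at hs
    exact gInf_eq hα hs.1
  rw [h1, intervalIntegral.integral_div, intervalIntegral.integral_comp_div _ hα.ne', zero_div,
    smul_eq_mul, mul_div_cancel_left₀ _ hα.ne']
  have h2 := intervalIntegral.integral_eq_sub_of_hasDerivAt_of_tendsto hy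
    (fun x hx => hasDerivAt_hankelCdf (1 / α) hx.1)
    (intervalIntegrable_hankelDensity ha hy.le) (tendsto_hankelCdf_zero ha)
    ((hasDerivAt_hankelCdf (1 / α) hy).continuousAt.tendsto.mono_left nhdsWithin_le_nhds)
  rw [h2, sub_zero]

/-! ### The expansion in powers of `a`. -/

/-- The coefficient of `a ^ k` in `e^{-aL}` times the distribution function, where
`L = log (1 - e^{-y})`. -/
noncomputable def expansionCoeff (k : ℕ) (y : ℝ) : ℝ :=
  (hankel (1 / 2) (fun z => (-(harm z + (Real.log (1 - Real.exp (-y)) : ℂ))) ^ k * z⁻¹) y).im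
    / (Real.pi * k.factorial)

theorem polyGrowth_exp_norm_harm {b : ℝ} (hb : 0 ≤ b) :
    PolyGrowth fun t => ((Real.exp (b * ‖harm (hankelPath (1 / 2) t)‖) : ℝ) : ℂ) := by
  obtain ⟨C, -, N, h⟩ := exists_exp_mul_norm_harm_le (c := 1 / 2) (by norm_num) hb
  refine ⟨?_, C, N, fun t ht => ?_⟩
  · refine Complex.continuous_ofReal.comp_continuousOn (Real.continuous_exp.comp_continuousOn
      (continuousOn_const.mul ((polyGrowth_harm (by norm_num)).1.norm)))
  · rw [Complex.norm_real, Real.norm_of_nonneg (Real.exp_pos _).le]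
    exact h t ht

/-- Dominated convergence: the absolute series sums to `e^{|a|(|H| + |L|)}` times `|e^{zy}/z|`,
integrable since `e^{|a||H|}` has polynomial growth. -/
theorem hasSum_hankel_pow (a L : ℝ) {y : ℝ} (hy : 0 < y) :
    HasSum (fun k : ℕ => (a ^ k / k.factorial : ℂ)
        * hankel (1 / 2) (fun z => (-(harm z + (L : ℂ))) ^ k * z⁻¹) y)
      (hankel (1 / 2) (fun z => Complex.exp (-(a : ℂ) * (harm z + L)) * z⁻¹) y) := by
  have hc : (0 : ℝ) < 1 / 2 := by norm_num
  have hh : PolyGrowth fun t => harm (hankelPath (1 / 2) t) := polyGrowth_harm (by norm_num)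
  have hi := polyGrowth_inv_hankelPath hc
  have hpow : ∀ k : ℕ, PolyGrowth fun t => (-(harm (hankelPath (1 / 2) t) + (L : ℂ))) ^ k
      * (hankelPath (1 / 2) t)⁻¹ := by
    intro k
    have h1 := ((polyGrowth_const (-1)).mul (hh.add (polyGrowth_const (L : ℂ)))).pow k
    simpa using h1.mul hi
  set w : ℝ → ℂ := fun t => hankelDir t * Complex.exp (hankelPath (1 / 2) t * y) with hw
  have hF : ∀ k : ℕ, (a ^ k / k.factorial : ℂ)
      * hankel (1 / 2) (fun z => (-(harm z + (L : ℂ))) ^ k * z⁻¹) y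
      = ∫ t in Set.Ioi (0 : ℝ), (a ^ k / k.factorial : ℂ) * (hankelDir t
        * (Complex.exp (hankelPath (1 / 2) t * y) * ((-(harm (hankelPath (1 / 2) t) + (L : ℂ))) ^ k
          * (hankelPath (1 / 2) t)⁻¹))) := by
    intro k
    rw [integral_const_mul]
    rfl
  simp only [hF]
  set bound : ℕ → ℝ → ℝ := fun k t => (|a| * (‖harm (hankelPath (1 / 2) t)‖ + |L|)) ^ k / k.factorial
    * (‖Complex.exp (hankelPath (1 / 2) t * y)‖ * ‖(hankelPath (1 / 2) t)⁻¹‖) with hbound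
  have hbs : ∀ t, HasSum (fun k => bound k t)
      (Real.exp (|a| * (‖harm (hankelPath (1 / 2) t)‖ + |L|))
        * (‖Complex.exp (hankelPath (1 / 2) t * y)‖ * ‖(hankelPath (1 / 2) t)⁻¹‖)) := by
    intro t
    have h := NormedSpace.expSeries_div_hasSum_exp (|a| * (‖harm (hankelPath (1 / 2) t)‖ + |L|))
    rw [← Real.exp_eq_exp_ℝ] at h
    exact h.mul_right _
  refine hasSum_integral_of_dominated_convergence bound (fun k => ?_) (fun k => ?_)
    (Eventually.of_forall fun t => (hbs t).summable) ?_ (Eventually.of_forall fun t => ?_)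
  · exact (aestronglyMeasurable_hankel
      (A := fun z => (-(harm z + (L : ℂ))) ^ k * z⁻¹) (hpow k) y).const_mul _
  · refine Eventually.of_forall fun t => ?_
    simp only [hbound]
    rw [norm_mul, norm_mul, norm_mul, norm_mul, norm_hankelDir, one_mul, norm_div, norm_pow,
      norm_pow, norm_neg, Complex.norm_real, Complex.norm_natCast, Real.norm_eq_abs, mul_pow]
    have h1 : ‖harm (hankelPath (1 / 2) t) + (L : ℂ)‖ ≤ ‖harm (hankelPath (1 / 2) t)‖ + |L| := by
      refine (norm_add_le _ _).trans ?_
      rw [Complex.norm_real, Real.norm_eq_abs]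
    calc |a| ^ k / k.factorial * (‖Complex.exp (hankelPath (1 / 2) t * y)‖
          * (‖harm (hankelPath (1 / 2) t) + (L : ℂ)‖ ^ k * ‖(hankelPath (1 / 2) t)⁻¹‖))
        ≤ |a| ^ k / k.factorial * (‖Complex.exp (hankelPath (1 / 2) t * y)‖
          * ((‖harm (hankelPath (1 / 2) t)‖ + |L|) ^ k * ‖(hankelPath (1 / 2) t)⁻¹‖)) := by
          gcongr
      _ = _ := by ring
  · have h1 := integrableOn_hankel (c := 1 / 2) (y := y)
      (A := fun z => ((Real.exp (|a| * |L|) : ℝ) : ℂ) * (((Real.exp (|a| * ‖harm z‖) : ℝ) : ℂ) * z⁻¹))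
      ((polyGrowth_const _).mul ((polyGrowth_exp_norm_harm (abs_nonneg a)).mul hi)) hy
    refine h1.norm.congr (Eventually.of_forall fun t => ?_)
    simp only [(hbs t).tsum_eq]
    rw [norm_mul, norm_mul, norm_mul, norm_mul, norm_hankelDir, one_mul, Complex.norm_real,
      Complex.norm_real, Real.norm_of_nonneg (Real.exp_pos _).le,
      Real.norm_of_nonneg (Real.exp_pos _).le, mul_add, Real.exp_add]
    ring
  · have h := NormedSpace.expSeries_div_hasSum_exp
      (-(a : ℂ) * (harm (hankelPath (1 / 2) t) + L))
    rw [← Complex.exp_eq_exp_ℂ] at h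
    have h2 := (h.mul_right ((hankelPath (1 / 2) t)⁻¹)).mul_left (w t)
    simp only [hw] at h2
    rw [← mul_assoc]
    refine h2.congr_fun fun k => ?_
    rw [show -(a : ℂ) * (harm (hankelPath (1 / 2) t) + L)
      = a * -(harm (hankelPath (1 / 2) t) + L) by ring, mul_pow]
    ring

theorem hasSum_expansionCoeff {a y : ℝ} (hy : 0 < y) :
    HasSum (fun k : ℕ => expansionCoeff k y * a ^ k)
      (Real.exp (-(a * Real.log (1 - Real.exp (-y)))) * hankelCdf a y) := by
  set L : ℝ := Real.log (1 - Real.exp (-y)) with hL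
  have h := Complex.hasSum_im (hasSum_hankel_pow a L hy)
  have h2 := h.div_const Real.pi
  have e : hankel (1 / 2) (fun z => Complex.exp (-(a : ℂ) * (harm z + L)) * z⁻¹) y
      = ((Real.exp (-(a * L)) : ℝ) : ℂ)
        * hankel (1 / 2) (fun z => Complex.exp (-(a : ℂ) * harm z) * z⁻¹) y := by
    rw [← hankel_const_mul]
    refine hankel_congr (fun t _ => ?_) y
    rw [mul_add, Complex.exp_add]
    push_cast
    rw [neg_mul (a : ℂ) (L : ℂ)]
    ring
  rw [e, Complex.im_ofReal_mul, mul_div_assoc] at h2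
  refine h2.congr_fun fun k => ?_
  rw [show (a ^ k / k.factorial : ℂ) = ((a ^ k / k.factorial : ℝ) : ℂ) by push_cast; rfl,
    Complex.im_ofReal_mul]
  unfold expansionCoeff
  rw [← hL]
  have := Real.pi_ne_zero
  field_simp

theorem expansionCoeff_zero {y : ℝ} (hy : 0 < y) : expansionCoeff 0 y = 1 := by
  unfold expansionCoeff
  rw [hankel_congr (B := fun z => z⁻¹) (fun t _ => by simp), hankel_inv_im (by norm_num) hy]
  simp [Real.pi_ne_zero]

/-- `I_1 + L I_0 = -πL + Lπ`: the prefactor `(1 - e^{-y})^{1/α}` is exactly what removes the first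
order. -/
theorem expansionCoeff_one {y : ℝ} (hy : 0 < y) : expansionCoeff 1 y = 0 := by
  have hc : (0 : ℝ) < 1 / 2 := by norm_num
  have hi := polyGrowth_inv_hankelPath hc
  have hhi := ((polyGrowth_harm (c := 1 / 2) (by norm_num)).pow 1).mul hi
  set L : ℝ := Real.log (1 - Real.exp (-y)) with hL
  have h1 := hankel_im_add (c := 1 / 2) (A := fun z => harm z ^ 1 * z⁻¹) (B := fun z => z⁻¹)
    hhi hi hy L
  unfold expansionCoeff
  rw [hankel_congr (B := fun z => ((-1 : ℝ) : ℂ) * (harm z ^ 1 * z⁻¹ + (L : ℂ) * z⁻¹))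
    (fun t _ => by push_cast; ring), hankel_const_mul, Complex.im_ofReal_mul, h1,
    hankel_harm_div_im hy, hankel_inv_im hc hy, ← hL]
  ring

/-- `I_2 + 2L I_1 + L² I_0 = π(L² + 2f₂ - 2L² + L²)`, to be divided by `2! π`. -/
theorem expansionCoeff_two {y : ℝ} (hy : 0 < y) : expansionCoeff 2 y = fTwo y := by
  have hc : (0 : ℝ) < 1 / 2 := by norm_num
  have hi := polyGrowth_inv_hankelPath hc
  have hh := polyGrowth_harm (c := 1 / 2) (by norm_num)
  have hhi := (hh.pow 1).mul hi
  have hhi2 := (hh.pow 2).mul hi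
  set L : ℝ := Real.log (1 - Real.exp (-y)) with hL
  have h1 := hankel_im_add (c := 1 / 2) (A := fun z => harm z ^ 2 * z⁻¹)
    (B := fun z => harm z ^ 1 * z⁻¹) hhi2 hhi hy (2 * L)
  have h2 := hankel_im_add (c := 1 / 2)
    (A := fun z => harm z ^ 2 * z⁻¹ + ((2 * L : ℝ) : ℂ) * (harm z ^ 1 * z⁻¹))
    (B := fun z => z⁻¹) (hhi2.add ((polyGrowth_const _).mul hhi)) hi hy (L ^ 2)
  unfold expansionCoeff
  rw [hankel_congr (B := fun z => harm z ^ 2 * z⁻¹ + ((2 * L : ℝ) : ℂ) * (harm z ^ 1 * z⁻¹)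
    + ((L ^ 2 : ℝ) : ℂ) * z⁻¹) (fun t _ => by push_cast; ring), h2, h1,
    hankel_harm_sq_div_im hy, hankel_harm_div_im hy, hankel_inv_im hc hy, ← hL]
  have := Real.pi_ne_zero
  norm_num [Nat.factorial]
  field_simp
  ring

/-- The expansion of the distribution function. At `y = 0` the prefactor vanishes, so that the
coefficients `f k 0` with `k ≥ 3` are unconstrained and set to `0`. -/
theorem mainTheorem5 :
    -- the density and its integral are well defined
    (∀ α : ℝ, 0 < α →
      (∀ s : ℝ, 0 < s →
        Tendsto (fun T : ℝ => gInfTrunc α s T) atTop (𝓝 ((gInf α s : ℝ) : ℂ))) ∧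
      (∀ σ : ℝ, 0 ≤ σ → IntervalIntegrable (gInf α) volume 0 σ)) ∧
    -- the expansion in inverse powers of `α` at fixed `y = σ / α`
    (∃ f : ℕ → ℝ → ℝ,
      (∀ y : ℝ, 0 ≤ y → f 1 y = 0) ∧
      (∀ y : ℝ, 0 ≤ y → f 2 y = fTwo y) ∧
      ∀ α σ y : ℝ, 0 < α → 0 ≤ σ → y = σ / α →
        Summable (fun k : ℕ => f (k + 1) y / α ^ (k + 1)) ∧
        GInf α σ =
          (1 - Real.exp (-y)) ^ (1 / α) * (1 + ∑' k : ℕ, f (k + 1) y / α ^ (k + 1))) ∧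
    -- `f₂` is monotone from `-π² / 12` at `0` to `0` at infinity
    MonotoneOn fTwo (Set.Ici 0) ∧
    fTwo 0 = -(Real.pi ^ 2 / 12) ∧
    Tendsto fTwo (𝓝[>] 0) (𝓝 (-(Real.pi ^ 2 / 12))) ∧
    Tendsto fTwo atTop (𝓝 0) := by
  refine ⟨fun α hα => ⟨fun s hs => ?_, fun σ hσ => intervalIntegrable_gInf hα hσ⟩,
    ⟨fun k y => if 0 < y then expansionCoeff k y else if k = 2 then fTwo 0 else 0, ?_, ?_, ?_⟩,
    monotoneOn_fTwo, fTwo_zero, tendsto_fTwo_zero, tendsto_fTwo_atTop⟩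
  · rw [gInf_eq hα hs]
    exact tendsto_gInfTrunc hα hs
  · intro y _
    by_cases h : 0 < y
    · simp [h, expansionCoeff_one h]
    · simp [h]
  · intro y hy
    rcases hy.eq_or_lt with rfl | h
    · simp
    · simp [h, expansionCoeff_two h]
  · intro α σ y hα hσ hyσ
    rcases hσ.eq_or_lt with rfl | hσ'
    · rw [zero_div] at hyσ
      subst hyσ
      constructor
      -- The series is indexed by `k + 1`, so index `1` is the term of `f₂`, the only one that is
      -- nonzero at `y = 0`.
      · refine summable_of_ne_finset_zero (s := {1}) fun k hk => ?_
        have : k ≠ 1 := by simpa using hk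
        simp [this]
      · simp [GInf, Real.zero_rpow (inv_ne_zero hα.ne')]
    · have hy : 0 < y := by rw [hyσ]; positivity
      have hs := hasSum_expansionCoeff (a := 1 / α) hy
      have hs1 := (hasSum_nat_add_iff' 1).2 hs
      rw [Finset.sum_range_one, expansionCoeff_zero hy, pow_zero, mul_one] at hs1
      have e : ∀ k : ℕ, expansionCoeff (k + 1) y * (1 / α) ^ (k + 1)
          = expansionCoeff (k + 1) y / α ^ (k + 1) := by
        intro k
        rw [one_div, inv_pow, div_eq_mul_inv]
      simp only [e] at hs1
      simp only [hy, if_true]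
      refine ⟨hs1.summable, ?_⟩
      rw [hs1.tsum_eq, GInf_eq hα hσ', ← hyσ, Real.rpow_def_of_pos (one_sub_exp_neg_pos hy)]
      rw [add_sub_cancel, ← mul_assoc, ← Real.exp_add]
      rw [mul_comm (1 / α), add_neg_cancel, Real.exp_zero, one_mul]
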